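/- Let $\mathcal X\subseteq\mathbb R^n$ be closed and convex, let $U\supseteq\mathcal X$ be open and convex (for instance $U=\mathbb R^n$), let $P$ be a probability measure on a measurable space $\mathcal S$, and let $f:U\times\mathcal S\to\mathbb R$ be such that $f(x;\cdot)$ is measurable for every $x\in U$, $f(x;\cdot)$ is $P$-integrable for every $x\in\mathcal X$, and, for every $s\in\mathcal S$, $f(\cdot;s)$ is $\rho(s)$-weakly convex on $U$, i.e. $x\mapsto f(x;s)+\frac{\rho(s)}2\|x\|_2^2$ is convex, where $\rho:\mathcal S\to\mathbb R$ is $P$-integrable. Put $F(x)=\mathbb E_P[f(x;S)]$ for $x\in\mathcal X$ and assume that $F$ attains its minimum over $\mathcal X$. Write $\partial$ for the Fréchet subdifferential in $\mathbb R^n$ (taken in the variable $x$, respectively $y$). Assume that there is a nondecreasing $G_{\mathrm{big}}:[0,\infty)\to[0,\infty)$ such that $\mathbb E_P\big[\|f'(x;S)\|_2^2\big]\le G_{\mathrm{big}}(\|x\|_2)$ for all $x\in\mathcal X$ and all selections $f'(x;s)\in\partial f(x;s)$. Let $f_x(\cdot;s):U\to\mathbb R$ $(x\in\mathcal X,\ s\in\mathcal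 S)$ be models satisfying (C.i) $y\mapsto f_x(y;s)$ is convex and subdifferentiable on $U$; (C.ii) $f_x(y;s)\le f(y;s)+\frac{\rho(s)}2\|y-x\|_2^2$ for all $y\in\mathcal X$; (C.iii) $f_x(x;s)=f(x;s)$ and $\partial_yf_x(y;s)|_{y=x}\subseteq\partial f(x;s)$. Let $\alpha_k>0$ with $\sum_k\alpha_k^2<\infty$, let $S_1,S_2,\dots$ be i.i.d. with law $P$, let $x_1\in\mathcal X$ and $$x_{k+1}=\operatorname*{argmin}_{y\in\mathcal X}\Big\{f_{x_k}(y;S_k)+\frac1{2\alpha_k}\|y-x_k\|_2^2\Big\},\qquad k\ge1,$$ where $x_k$ is $\sigma(S_1,\dots,S_{k-1})$-measurable for every $k$. Let $\lambda\ge0$ satisfy $\mathbb E_P[\rho(S)]<\lambda$, and let $F_\lambda(x)=\inf_{y\in\mathcal X}\{F(y)+\frac\lambda2\|y-x\|_2^2\}$, $x\in\mathbb R^n$, be the Moreau envelope. Then $F_\lambda$ is differentiable on $\mathbb R^n$, and there is a finite random variable $G_\lambda$ such that, with probability one, on the event $\{\sup_k\|x_k\|_2<\infty\}$, $$\sum_k\alpha_k\|\nabla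 F_\lambda(x_k)\|_2^2<\infty\qquad\text{and}\qquad F_\lambda(x_k)\to G_\lambda .$$ Let $\mathcal X^{\mathrm{stat}}=\{x\in\mathcal X: 0\in\partial(F+I_{\mathcal X})(x)\}$ be the set of stationary points of $F$ over $\mathcal X$, where $I_{\mathcal X}$ is $0$ on $\mathcal X$ and $+\infty$ elsewhere. If in addition $\sum_k\alpha_k=\infty$ and $F(\mathcal X^{\mathrm{stat}})$ has Lebesgue measure zero (weak Sard condition), then, with probability one, on the event $\{\sup_k\|x_k\|_2<\infty\}$, $$\|\nabla F_\lambda(x_k)\|_2\to0\qquad\text{and}\qquad\operatorname{dist}(x_k,\mathcal X^{\mathrm{stat}})\to0 .$$ -/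

import Mathlib

open MeasureTheory ProbabilityTheory Filter Topology
open scoped NNReal ENNReal

noncomputable section

namespace StochModel

/-- The Fréchet subdifferential at `x` of the function that equals `g` on `C` and `+∞` off `C`:
the vectors `v` such that `x ∈ C` and
`g y ≥ g x + ⟪v, y - x⟫ - o(‖y - x‖)` as `y → x` within `C`.
For `C = Set.univ` this is the usual Fréchet subdifferential of `g : E → ℝ`. -/
def frechetSubdiffOn {E : Type*} [NormedAddCommGroup E] [InnerProductSpace ℝ E]
    (C : Set E) (g : E → ℝ) (x : E) : Set E :=
  {v | x ∈ C ∧ ∀ ε : ℝ, 0 < ε →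
    ∀ᶠ y in 𝓝[C] x, g x + inner ℝ v (y - x) - ε * ‖y - x‖ ≤ g y}

/-- The Fréchet subdifferential of `g : E → ℝ` at `x`. -/
def frechetSubdiff {E : Type*} [NormedAddCommGroup E] [InnerProductSpace ℝ E]
    (g : E → ℝ) (x : E) : Set E :=
  frechetSubdiffOn Set.univ g x

/-- `g` is `r`-weakly convex on `U`: `g + (r / 2) ‖·‖²` is convex on `U` (`r` may be negative). -/
def WeaklyConvexOn {E : Type*} [NormedAddCommGroup E] [InnerProductSpace ℝ E]
    (U : Set E) (r : ℝ) (g : E → ℝ) : Prop :=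
  ConvexOn ℝ U (fun x => g x + r / 2 * ‖x‖ ^ 2)

/-- The population objective `F(x) = E_P[f(x; S)]`. -/
def objective {E S : Type*} [MeasurableSpace S] (P : Measure S) (f : E → S → ℝ) (x : E) : ℝ :=
  ∫ s, f x s ∂P

/-- The Moreau envelope `F_lam(x) = inf_{y ∈ X} (F(y) + (lam / 2) ‖y - x‖²)`. -/
def moreauEnvelope {E : Type*} [NormedAddCommGroup E]
    (X : Set E) (F : E → ℝ) (lam : ℝ) (x : E) : ℝ :=
  ⨅ y : X, (F y + lam / 2 * ‖(y : E) - x‖ ^ 2)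

/-- The stationary points of `F` over `X`: those `x ∈ X` with `0 ∈ ∂(F + I_X)(x)`, where `I_X` is
the `0`/`+∞` indicator of `X`. -/
def stationarySet {E : Type*} [NormedAddCommGroup E] [InnerProductSpace ℝ E]
    (X : Set E) (F : E → ℝ) : Set E :=
  {x | (0 : E) ∈ frechetSubdiffOn X F x}

/-- The second moments of the subgradients of the losses are bounded on compacta: for a monotone
`G`, every `x ∈ X` and every selection `g(s) ∈ ∂f(x; s)` satisfy `E‖g(S)‖² ≤ G(‖x‖)`. -/
def SubgradSecondMomentBound {E S : Type*} [NormedAddCommGroup E] [InnerProductSpace ℝ E]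
    [MeasurableSpace S] (P : Measure S) (X : Set E) (f : E → S → ℝ) : Prop :=
  ∃ G : ℝ≥0 → ℝ≥0, Monotone G ∧
    ∀ x ∈ X, ∀ g : S → E, (∀ s, g s ∈ frechetSubdiff (fun y => f y s) x) →
      ∫⁻ s, ‖g s‖ₑ ^ 2 ∂P ≤ (G ‖x‖₊ : ℝ≥0∞)

/-- `m x s : E → ℝ` is a model of the loss `f(·; s)` at each `x ∈ X`. -/
structure IsModel {E S : Type*} [NormedAddCommGroup E] [InnerProductSpace ℝ E]
    (X U : Set E) (f : E → S → ℝ) (ρ : S → ℝ) (m : E → S → E → ℝ) : Prop where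
  convex : ∀ x ∈ X, ∀ s, ConvexOn ℝ U (m x s)
  subdifferentiable : ∀ x ∈ X, ∀ s, ∀ y ∈ U, (frechetSubdiff (m x s) y).Nonempty
  weak_lower : ∀ x ∈ X, ∀ s, ∀ y ∈ X, m x s y ≤ f y s + ρ s / 2 * ‖y - x‖ ^ 2
  exact_at : ∀ x ∈ X, ∀ s, m x s x = f x s
  subdiff_subset : ∀ x ∈ X, ∀ s,
    frechetSubdiff (m x s) x ⊆ frechetSubdiff (fun y => f y s) x

/-- The `σ`-field generated by the samples `ξ 0, …, ξ (k - 1)`. -/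
abbrev pastSigma {Ω S : Type*} [MeasurableSpace S] (ξ : ℕ → Ω → S) (k : ℕ) : MeasurableSpace Ω :=
  ⨆ j : ℕ, ⨆ _ : j < k, MeasurableSpace.comap (ξ j) inferInstance

/-- `x 0, x 1, …` are the iterates of the model-based method with model `m`, step sizes `α` and
samples `ξ 0, ξ 1, …`: the iterate `x k` is a function of the samples before `ξ k`, and
`x (k + 1)` minimizes `m (x k) (ξ k) + (1 / (2 α k)) ‖· - x k‖²` over `X`. -/
structure IsModelIteration {E S Ω : Type*} [NormedAddCommGroup E] [MeasurableSpace E]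
    [MeasurableSpace S] (X : Set E) (m : E → S → E → ℝ) (α : ℕ → ℝ) (ξ : ℕ → Ω → S)
    (x : ℕ → Ω → E) : Prop where
  adapted : ∀ k, Measurable[pastSigma ξ k] (x k)
  init_mem : ∀ ω, x 0 ω ∈ X
  step_mem : ∀ k ω, x (k + 1) ω ∈ X
  step_min : ∀ k ω, IsMinOn
    (fun y => m (x k ω) (ξ k ω) y + 1 / (2 * α k) * ‖y - x k ω‖ ^ 2) X (x (k + 1) ω)

end StochModel

end

/-!
The argument follows one run of the method through the Moreau envelope of the objective `F`.

Since the mean `r` of the moduli `ρ` is less than `lam`, the function `F + (lam / 2) ‖· - x‖²` is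
strongly convex on `X`, with modulus `c = lam - r`. For `lam > 0` its minimizer over `X` is the
proximal point `p x` (`IsProxMap`). The map `p` is Lipschitz, the envelope has gradient
`lam • (x - p x)` (`IsProxMap.hasGradientAt_moreauEnvelope`), and the fixed points of `p` are
stationary for `F` over `X`.

The model step is the minimization of a strongly convex function. Comparing the new iterate `x⁺`
with `q = p x` and using that the model lies below the loss up to `(ρ / 2) ‖· - x‖²`, while its
subgradients at `x` are subgradients of the loss, gives
`‖q - x⁺‖² ≤ ‖q - x‖² + 2 α (f(q; S) - f(x; S) + (ρ(S) / 2) ‖q - x‖²) + α² Q(x, S)`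
(`IsModel.norm_sub_step_sq_le`). Here `Q` is a jointly measurable bound of the squared subgradients,
built from directional derivatives (`exists_isSubgradBound`): the moment assumption concerns
arbitrary selections of subgradients, and it passes to `Q` because the directional derivative in
each direction is attained by a subgradient (`exists_subgradient_tendsto_of_convexOn`). The sample
is independent of the past, so it can be integrated out. As `q` is a candidate in the infimum
defining the envelope at `x⁺`, the envelope decreases in mean by `lam α c ‖p x - x‖²` up to `O(α²)`,
over every event of the past on which the iterate is bounded
(`IsModelRun.setIntegral_envelope_le`). Stopping the run when it leaves a ball makes all the
processes bounded. Martingale convergence then yields the limit of the envelope and the summability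
of `α k ‖p (x k) - x k‖²` (`IsModelRun.ae_of_norm_le`).

For the second part, let `d k = ‖p (x k) - x k‖`. This residual changes by at most a multiple of
`‖x (k + 1) - x k‖`, and `‖x (k + 1) - x k‖² ≤ α k² Q (x k, S k)`. Hence the sums of
`d k² ‖x (k + 1) - x k‖` and of `‖x (k + 1) - x k‖²` are almost surely finite, so the increments of
`d ^ 3` are summable and `d` converges. If `∑ α k` diverges, the limit can only be `0`
(`tendsto_zero_of_summable_increments`). Compactness turns this into convergence to the stationary
set. When `lam = 0` the envelope is constant, and the distance to the stationary set is controlled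
by the envelope with parameter `1` instead.
-/

namespace StochModel

/-! ### Subgradients of weakly convex functions -/

section Subgradients

variable {E : Type*} [NormedAddCommGroup E] [InnerProductSpace ℝ E]

theorem weaklyConvexOn_iff_strongConvexOn {U : Set E} {r : ℝ} {g : E → ℝ} :
    WeaklyConvexOn U r g ↔ StrongConvexOn U (-r) g := by
  rw [strongConvexOn_iff_convex, WeaklyConvexOn]
  have : (fun x => g x + r / 2 * ‖x‖ ^ 2) = fun x => g x - -r / 2 * ‖x‖ ^ 2 := by
    funext x; ring
  rw [this]

/-- The convexity inequality of a strongly convex function on the segment from `x` to `y`. -/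
theorem strongConvexOn_segment {U : Set E} {c : ℝ} {g : E → ℝ} (hg : StrongConvexOn U c g)
    {x y : E} (hx : x ∈ U) (hy : y ∈ U) {t : ℝ} (ht0 : 0 ≤ t) (ht1 : t ≤ 1) :
    x + t • (y - x) ∈ U ∧
      g (x + t • (y - x)) ≤ g x + t * (g y - g x) - t * (1 - t) * (c / 2 * ‖y - x‖ ^ 2) := by
  have e : x + t • (y - x) = (1 - t) • x + t • y := by module
  have h1 : (1 - t) + t = 1 := by ring
  rw [e]
  refine ⟨hg.1 hx hy (by linarith) ht0 h1, ?_⟩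
  have := hg.2 hx hy (by linarith : 0 ≤ 1 - t) ht0 h1
  simp only [smul_eq_mul] at this
  rw [norm_sub_rev y x]
  linarith

/-- A strongly convex function grows quadratically away from a minimizer. -/
theorem strongConvexOn_growth {U : Set E} {c : ℝ} {g : E → ℝ} (hg : StrongConvexOn U c g)
    {x y : E} (hx : x ∈ U) (hmin : IsMinOn g U x) (hy : y ∈ U) :
    g x + c / 2 * ‖y - x‖ ^ 2 ≤ g y := by
  have key : ∀ t ∈ Set.Ioo (0 : ℝ) 1, g x + (1 - t) * (c / 2 * ‖y - x‖ ^ 2) ≤ g y := by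
    intro t ht
    obtain ⟨hm, hle⟩ := strongConvexOn_segment hg hx hy ht.1.le ht.2.le
    have h2 : g x ≤ g (x + t • (y - x)) := hmin hm
    have h3 : 0 ≤ t * ((g y - g x) - (1 - t) * (c / 2 * ‖y - x‖ ^ 2)) := by linarith
    have := nonneg_of_mul_nonneg_right h3 ht.1
    linarith
  have hlim : Tendsto (fun t : ℝ => g x + (1 - t) * (c / 2 * ‖y - x‖ ^ 2)) (𝓝[>] 0)
      (𝓝 (g x + (1 - 0) * (c / 2 * ‖y - x‖ ^ 2))) :=
    (Continuous.tendsto (by fun_prop) 0).mono_left nhdsWithin_le_nhds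
  have := le_of_tendsto hlim (by
    filter_upwards [Ioo_mem_nhdsGT (zero_lt_one' ℝ)] with t ht using key t ht)
  simpa using this

/-- A first-order lower bound up to a quadratic error certifies a Fréchet subgradient. -/
theorem mem_frechetSubdiffOn_of_quadratic {C : Set E} {g : E → ℝ} {x v : E} (hx : x ∈ C) (c : ℝ)
    (h : ∀ᶠ y in 𝓝[C] x, g x + inner ℝ v (y - x) - c * ‖y - x‖ ^ 2 ≤ g y) :
    v ∈ frechetSubdiffOn C g x := by
  refine ⟨hx, fun ε hε => ?_⟩
  have hlim : Tendsto (fun y : E => c * ‖y - x‖) (𝓝[C] x) (𝓝 (c * ‖x - x‖)) :=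
    (Continuous.tendsto (by fun_prop) x).mono_left nhdsWithin_le_nhds
  rw [sub_self, norm_zero, mul_zero] at hlim
  filter_upwards [h, hlim.eventually (gt_mem_nhds hε)] with y hy1 hy2
  nlinarith [norm_nonneg (y - x)]

/-- For a weakly convex function, a Fréchet subgradient gives a global lower bound with a
quadratic error. -/
theorem WeaklyConvexOn.le_of_mem_frechetSubdiff {U : Set E} {r : ℝ} {g : E → ℝ}
    (hg : WeaklyConvexOn U r g) {x y v : E} (hx : x ∈ U) (hy : y ∈ U)
    (hv : v ∈ frechetSubdiff g x) :
    g x + inner ℝ v (y - x) - r / 2 * ‖y - x‖ ^ 2 ≤ g y := by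
  rw [weaklyConvexOn_iff_strongConvexOn] at hg
  have hpath : Tendsto (fun t : ℝ => x + t • (y - x)) (𝓝[>] 0) (𝓝 x) := by
    have : Tendsto (fun t : ℝ => x + t • (y - x)) (𝓝 0) (𝓝 (x + (0 : ℝ) • (y - x))) :=
      Continuous.tendsto (by fun_prop) 0
    rw [zero_smul, add_zero] at this
    exact this.mono_left nhdsWithin_le_nhds
  have step : ∀ ε : ℝ, 0 < ε →
      inner ℝ v (y - x) - ε * ‖y - x‖ ≤ g y - g x + r / 2 * ‖y - x‖ ^ 2 := by
    intro ε hε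
    have hev := hv.2 ε hε
    rw [nhdsWithin_univ] at hev
    have hlim : Tendsto (fun t : ℝ => g y - g x + (1 - t) * (r / 2 * ‖y - x‖ ^ 2)) (𝓝[>] 0)
        (𝓝 (g y - g x + (1 - 0) * (r / 2 * ‖y - x‖ ^ 2))) :=
      (Continuous.tendsto (by fun_prop) 0).mono_left nhdsWithin_le_nhds
    have := ge_of_tendsto hlim (b := inner ℝ v (y - x) - ε * ‖y - x‖) (by
      filter_upwards [Ioo_mem_nhdsGT (zero_lt_one' ℝ), hpath.eventually hev] with t ht h1
      obtain ⟨-, h2⟩ := strongConvexOn_segment hg hx hy ht.1.le ht.2.le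
      rw [add_sub_cancel_left, inner_smul_right, norm_smul, Real.norm_eq_abs,
        abs_of_pos ht.1] at h1
      have h3 : 0 ≤ t * ((g y - g x + (1 - t) * (r / 2 * ‖y - x‖ ^ 2)) -
          (inner ℝ v (y - x) - ε * ‖y - x‖)) := by linarith
      have := nonneg_of_mul_nonneg_right h3 ht.1
      linarith)
    simpa using this
  have hlim : Tendsto (fun ε : ℝ => inner ℝ v (y - x) - ε * ‖y - x‖) (𝓝[>] 0)
      (𝓝 (inner ℝ v (y - x) - 0 * ‖y - x‖)) :=
    (Continuous.tendsto (by fun_prop) 0).mono_left nhdsWithin_le_nhds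
  have := le_of_tendsto hlim (by
    filter_upwards [self_mem_nhdsWithin] with ε hε using step ε hε)
  linarith

theorem le_of_mem_frechetSubdiff_of_convexOn {U : Set E} {g : E → ℝ} (hg : ConvexOn ℝ U g)
    {x y v : E} (hx : x ∈ U) (hy : y ∈ U) (hv : v ∈ frechetSubdiff g x) :
    g x + inner ℝ v (y - x) ≤ g y := by
  have h : WeaklyConvexOn U 0 g := by simpa [WeaklyConvexOn] using hg
  simpa using h.le_of_mem_frechetSubdiff hx hy hv

theorem tendsto_add_inv_smul (x u : E) :
    Tendsto (fun n : ℕ => x + (n : ℝ)⁻¹ • u) atTop (𝓝 x) := by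
  have h := (tendsto_inv_atTop_nhds_zero_nat (𝕜 := ℝ)).smul_const u |>.const_add x
  simpa using h

variable [FiniteDimensional ℝ E]

/-- The max formula: along each direction `u`, some subgradient of a convex function attains the
directional derivative. It comes from separating the strict epigraph from the ray tangent to the
graph in the direction `u`. -/
theorem exists_subgradient_tendsto_of_convexOn {U : Set E} {h : E → ℝ} (hU : IsOpen U)
    (hh : ConvexOn ℝ U h) {x : E} (hx : x ∈ U) (u : E) :
    ∃ w : E, (∀ y ∈ U, h x + inner ℝ w (y - x) ≤ h y) ∧
      Tendsto (fun n : ℕ => (n : ℝ) * (h (x + (n : ℝ)⁻¹ • u) - h x)) atTop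
        (𝓝 (inner ℝ w u)) := by
  set γ : ℝ →ᵃ[ℝ] E := AffineMap.lineMap x (x + u) with hγ
  have hγt : ∀ t, γ t = x + t • u := by
    intro t; simp [hγ, AffineMap.lineMap_apply, add_comm]
  have hγc : Continuous γ := by
    have : (γ : ℝ → E) = fun t => x + t • u := funext hγt
    rw [this]; fun_prop
  have hk : ConvexOn ℝ (γ ⁻¹' U) (h ∘ γ) := hh.comp_affineMap γ
  have h0 : (0 : ℝ) ∈ interior (γ ⁻¹' U) := by
    rw [(hU.preimage hγc).interior_eq]; simpa [hγt] using hx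
  set p : ℝ := derivWithin (h ∘ γ) (Set.Ioi 0) 0 with hp
  have hder := hk.hasDerivWithinAt_rightDeriv_of_mem_interior h0
  have hslope : ∀ t : ℝ, 0 ≤ t → x + t • u ∈ U → h x + t * p ≤ h (x + t • u) := by
    intro t ht htU
    rcases ht.eq_or_lt with rfl | ht
    · simp
    have := hk.rightDeriv_le_slope_of_mem_interior h0 (y := t)
      (by simpa [hγt] using htU) ht
    rw [slope_def_field, Function.comp, Function.comp, hγt, hγt, zero_smul, add_zero, sub_zero,
      le_div_iff₀ ht] at this
    rw [← hp] at this
    linarith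
  have hlim : Tendsto (fun n : ℕ => (n : ℝ) * (h (x + (n : ℝ)⁻¹ • u) - h x)) atTop (𝓝 p) := by
    have h1 := hasDerivWithinAt_iff_tendsto_slope.1 hder
    have h2 : Tendsto (fun n : ℕ => (n : ℝ)⁻¹) atTop (𝓝[Set.Ioi 0 \ {0}] (0 : ℝ)) := by
      refine tendsto_nhdsWithin_iff.2 ⟨tendsto_inv_atTop_nhds_zero_nat, ?_⟩
      filter_upwards [eventually_gt_atTop 0] with n hn
      have : (0 : ℝ) < (n : ℝ)⁻¹ := by positivity
      exact ⟨this, this.ne'⟩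
    refine (h1.comp h2).congr fun n => ?_
    simp [slope_def_field, hγt, div_eq_inv_mul]
  have hopen : IsOpen {q : E × ℝ | q.1 ∈ U ∧ h q.1 < q.2} := by
    have hc : ContinuousOn (fun q : E × ℝ => q.2 - h q.1) (Prod.fst ⁻¹' U) :=
      continuousOn_snd.sub ((hh.continuousOn hU).comp continuousOn_fst fun q hq => hq)
    have := hc.isOpen_inter_preimage (hU.preimage continuous_fst) (isOpen_Ioi (a := (0 : ℝ)))
    convert this using 1
    ext q; simp [sub_pos]
  have hray : Convex ℝ {q : E × ℝ | ∃ t : ℝ, 0 ≤ t ∧ q = (x + t • u, h x + t * p)} := by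
    rintro _ ⟨s, hs, rfl⟩ _ ⟨t, ht, rfl⟩ a b ha hb hab
    refine ⟨a * s + b * t, by positivity, ?_⟩
    have hb' : b = 1 - a := by linarith
    subst hb'
    ext1
    · simp only [Prod.smul_mk, Prod.mk_add_mk]; module
    · simp only [Prod.smul_mk, Prod.mk_add_mk, smul_eq_mul]; ring
  obtain ⟨φ, c, hφ1, hφ2⟩ := geometric_hahn_banach_open hh.convex_strict_epigraph hopen hray (by
    rw [Set.disjoint_left]
    rintro _ ⟨hqU, hq⟩ ⟨t, ht, rfl⟩
    exact absurd (hslope t ht hqU) (not_le.2 hq))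
  -- `φ (y, a) = φ (y, 0) + a * β`, and the separation of points above `x` forces `β < 0`.
  set β : ℝ := φ (0, 1) with hβ
  have hφs : ∀ y : E, ∀ a : ℝ, φ (y, a) = φ (y, 0) + a * β := by
    intro y a
    have : (y, a) = (y, (0 : ℝ)) + a • ((0 : E), (1 : ℝ)) := by simp
    rw [this, map_add, map_smul, smul_eq_mul]
  have hβneg : β < 0 := by
    have h1 := hφ1 (x, h x + 1) ⟨hx, by simp⟩
    have h2 := hφ2 (x, h x) ⟨0, le_rfl, by simp⟩
    rw [hφs] at h1 h2
    linarith
  set w : E := (InnerProductSpace.toDual ℝ E).symm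
    ((-β)⁻¹ • (φ.comp (ContinuousLinearMap.inl ℝ E ℝ))) with hw
  have hwin : ∀ y : E, (-β) * inner ℝ w y = φ (y, 0) := by
    intro y
    rw [hw, InnerProductSpace.toDual_symm_apply]
    have : β ≠ 0 := hβneg.ne
    simp only [smul_apply, ContinuousLinearMap.comp_apply,
      ContinuousLinearMap.inl_apply, smul_eq_mul]
    field_simp
  have hle : ∀ y ∈ U, ∀ t : ℝ, 0 ≤ t →
      inner ℝ w y - h y ≤ inner ℝ w (x + t • u) - (h x + t * p) := by
    intro y hy t ht
    have h2 := hφ2 (x + t • u, h x + t * p) ⟨t, ht, rfl⟩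
    have h3 : φ (y, 0) + h y * β ≤ c := by
      refine le_of_forall_pos_lt_add fun ε hε => ?_
      have h1 := hφ1 (y, h y + ε / (-β)) ⟨hy, by
        have : 0 < ε / (-β) := div_pos hε (by linarith)
        simpa using this⟩
      rw [hφs] at h1
      have : ε / (-β) * β = -ε := by
        rw [div_neg, neg_mul, div_mul_cancel₀ _ hβneg.ne]
      linarith
    rw [hφs, ← hwin] at h2
    rw [← hwin] at h3
    have h4 : 0 ≤ (-β) * ((inner ℝ w (x + t • u) - (h x + t * p)) - (inner ℝ w y - h y)) := by
      linarith
    have := nonneg_of_mul_nonneg_right h4 (by linarith)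
    linarith
  have hsub : ∀ y ∈ U, h x + inner ℝ w (y - x) ≤ h y := by
    intro y hy
    have := hle y hy 0 le_rfl
    simp only [zero_smul, add_zero, zero_mul] at this
    rw [inner_sub_right]; linarith
  refine ⟨w, hsub, ?_⟩
  have hpw : p ≤ inner ℝ w u := by
    have := hle x hx 1 zero_le_one
    rw [one_smul, inner_add_right] at this
    linarith
  have hwp : inner ℝ w u ≤ p := by
    refine ge_of_tendsto hlim ?_
    filter_upwards [eventually_gt_atTop 0, (tendsto_add_inv_smul x u).eventually (hU.mem_nhds hx)]
      with n hn hnU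
    have := hsub _ hnU
    have hn' : (0 : ℝ) < n := by exact_mod_cast hn
    rw [add_sub_cancel_left, inner_smul_right] at this
    have h5 : (n : ℝ) * ((n : ℝ)⁻¹ * inner ℝ w u) = inner ℝ w u := by field_simp
    have h6 := mul_le_mul_of_nonneg_left
      (show (n : ℝ)⁻¹ * inner ℝ w u ≤ h (x + (n : ℝ)⁻¹ • u) - h x by linarith) hn'.le
    linarith
  rwa [le_antisymm hpw hwp] at hlim

/-- The max formula for weakly convex functions and their Fréchet subgradients. -/
theorem WeaklyConvexOn.exists_mem_frechetSubdiff_tendsto {U : Set E} {r : ℝ} {g : E → ℝ}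
    (hU : IsOpen U) (hg : WeaklyConvexOn U r g) {x : E} (hx : x ∈ U) (u : E) :
    ∃ v ∈ frechetSubdiff g x,
      Tendsto (fun n : ℕ => (n : ℝ) * (g (x + (n : ℝ)⁻¹ • u) - g x)) atTop
        (𝓝 (inner ℝ v u)) := by
  obtain ⟨w, hw, hlim⟩ := exists_subgradient_tendsto_of_convexOn hU hg hx u
  have hsq : ∀ y : E, ‖y‖ ^ 2 = ‖x‖ ^ 2 + 2 * inner ℝ x (y - x) + ‖y - x‖ ^ 2 := by
    intro y
    rw [← norm_add_sq_real, add_sub_cancel]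
  refine ⟨w - r • x, ?_, ?_⟩
  · refine mem_frechetSubdiffOn_of_quadratic (Set.mem_univ x) (r / 2) ?_
    rw [nhdsWithin_univ]
    filter_upwards [hU.mem_nhds hx] with y hy
    have := hw y hy
    rw [hsq y] at this
    rw [inner_sub_left, real_inner_smul_left]
    linarith
  · have hcorr : Tendsto (fun n : ℕ => r * inner ℝ x u + r / 2 * ((n : ℝ)⁻¹ * ‖u‖ ^ 2)) atTop
        (𝓝 (r * inner ℝ x u + r / 2 * (0 * ‖u‖ ^ 2))) :=
      ((tendsto_inv_atTop_nhds_zero_nat (𝕜 := ℝ)).mul_const _ |>.const_mul _).const_add _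
    have := hlim.sub hcorr
    rw [inner_sub_left, real_inner_smul_left]
    rw [zero_mul, mul_zero, add_zero] at this
    refine this.congr' ?_
    filter_upwards [eventually_gt_atTop 0] with n hn
    have hn' : (n : ℝ) ≠ 0 := by exact_mod_cast hn.ne'
    rw [hsq (x + (n : ℝ)⁻¹ • u), add_sub_cancel_left, inner_smul_right, norm_smul, mul_pow,
      Real.norm_eq_abs, sq_abs]
    field_simp
    ring

theorem WeaklyConvexOn.continuousOn {U : Set E} {r : ℝ} {g : E → ℝ}
    (hU : IsOpen U) (hg : WeaklyConvexOn U r g) : ContinuousOn g U := by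
  have h : ContinuousOn (fun x : E => g x + r / 2 * ‖x‖ ^ 2) U :=
    ConvexOn.continuousOn hU hg
  have h2 := h.sub (Continuous.continuousOn (f := fun x : E => r / 2 * ‖x‖ ^ 2) (by fun_prop))
  exact h2.congr fun x _ => by simp

end Subgradients

/-! ### Proximal maps and the Moreau envelope -/

section Prox

variable {E : Type*} [NormedAddCommGroup E]

/-- `p x` minimizes `F + (lam / 2) ‖· - x‖²` over `X` for every `x`, with quadratic growth of
modulus `c` away from the minimizer. -/
structure IsProxMap (X : Set E) (F : E → ℝ) (lam c : ℝ) (p : E → E) : Prop where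
  mem : ∀ x, p x ∈ X
  growth : ∀ x, ∀ y ∈ X, F (p x) + lam / 2 * ‖p x - x‖ ^ 2 + c / 2 * ‖y - p x‖ ^ 2 ≤
    F y + lam / 2 * ‖y - x‖ ^ 2

namespace IsProxMap

variable {X : Set E} {F : E → ℝ} {lam c : ℝ} {p : E → E}

theorem isLeast (hp : IsProxMap X F lam c p) (hc : 0 < c) (x : E) :
    IsLeast (Set.range fun y : X => F y + lam / 2 * ‖(y : E) - x‖ ^ 2)
      (F (p x) + lam / 2 * ‖p x - x‖ ^ 2) := by
  refine ⟨⟨⟨p x, hp.mem x⟩, rfl⟩, ?_⟩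
  rintro _ ⟨y, rfl⟩
  have := hp.growth x y y.2
  have h2 : 0 ≤ c / 2 * ‖(y : E) - p x‖ ^ 2 := by positivity
  dsimp only
  linarith

theorem moreauEnvelope_eq (hp : IsProxMap X F lam c p) (hc : 0 < c) (x : E) :
    moreauEnvelope X F lam x = F (p x) + lam / 2 * ‖p x - x‖ ^ 2 :=
  (hp.isLeast hc x).csInf_eq

theorem moreauEnvelope_le (hp : IsProxMap X F lam c p) (hc : 0 < c) (x : E) {y : E}
    (hy : y ∈ X) : moreauEnvelope X F lam x ≤ F y + lam / 2 * ‖y - x‖ ^ 2 := by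
  rw [hp.moreauEnvelope_eq hc]
  exact (hp.isLeast hc x).2 ⟨⟨y, hy⟩, rfl⟩

/-- The proximal point decreases `F` enough to absorb its weak convexity modulus `lam - c`. -/
theorem apply_sub_le (hp : IsProxMap X F lam c p) {x : E} (hx : x ∈ X) :
    F (p x) - F x + (lam - c) / 2 * ‖p x - x‖ ^ 2 ≤ -c * ‖p x - x‖ ^ 2 := by
  have h := hp.growth x x hx
  rw [sub_self, norm_zero, norm_sub_rev x (p x)] at h
  linarith

end IsProxMap

variable [InnerProductSpace ℝ E]

/-- Adding `(l / 2) ‖· - z‖²` raises the modulus of strong convexity by `l`. -/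
theorem strongConvexOn_add_sq {U : Set E} {c : ℝ} {g : E → ℝ} (hg : StrongConvexOn U c g)
    (l : ℝ) (z : E) : StrongConvexOn U (c + l) (fun y => g y + l / 2 * ‖y - z‖ ^ 2) := by
  refine ⟨hg.1, fun x hx y hy a b ha hb hab => ?_⟩
  have h := hg.2 hx hy ha hb hab
  have e : ‖a • x + b • y - z‖ ^ 2 =
      a * ‖x - z‖ ^ 2 + b * ‖y - z‖ ^ 2 - a * b * ‖x - y‖ ^ 2 := by
    have e1 : a • x + b • y - z = a • (x - z) + b • (y - z) := by
      have hb' : b = 1 - a := by linarith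
      subst hb'; module
    have e2 : x - y = (x - z) - (y - z) := by abel
    rw [e1, e2, norm_add_sq_real, norm_sub_sq_real (x - z), norm_smul, norm_smul, inner_smul_left,
      inner_smul_right, mul_pow, mul_pow, Real.norm_eq_abs, Real.norm_eq_abs, sq_abs, sq_abs]
    have hb' : b = 1 - a := by linarith
    subst hb'
    simp only [conj_trivial]; ring
  simp only [smul_eq_mul] at h ⊢
  rw [e]
  linarith

theorem exists_isProxMap [FiniteDimensional ℝ E] {X : Set E} {F : E → ℝ} {r lam : ℝ}
    (hX : IsClosed X) (hF : WeaklyConvexOn X r F) (hcont : ContinuousOn F X)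
    {z : E} (hz : z ∈ X) (hmin : IsMinOn F X z) (hlam : 0 < lam) :
    ∃ p : E → E, IsProxMap X F lam (lam - r) p := by
  have key : ∀ x : E, ∃ q ∈ X, IsMinOn (fun y => F y + lam / 2 * ‖y - x‖ ^ 2) X q := by
    intro x
    have hc : ContinuousOn (fun y => F y + lam / 2 * ‖y - x‖ ^ 2) X :=
      hcont.add (Continuous.continuousOn (by fun_prop))
    refine hc.exists_isMinOn' hX hz ?_
    have hd : Tendsto (fun y => lam / 2 * dist y x ^ 2) (cocompact E ⊓ 𝓟 X) atTop :=
      (((tendsto_pow_atTop two_ne_zero).comp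
        (tendsto_dist_right_cocompact_atTop x)).const_mul_atTop (half_pos hlam)).mono_left
          inf_le_left
    filter_upwards [hd.eventually_ge_atTop (lam / 2 * ‖z - x‖ ^ 2),
      mem_inf_of_right (mem_principal_self X)] with y hy hyX
    have h1 : F z ≤ F y := hmin hyX
    rw [dist_eq_norm] at hy
    linarith
  choose p hp hpm using key
  refine ⟨p, hp, fun x y hy => ?_⟩
  have hs := strongConvexOn_add_sq (weaklyConvexOn_iff_strongConvexOn.1 hF) lam x
  rw [neg_add_eq_sub] at hs
  exact strongConvexOn_growth hs (hp x) (hpm x) hy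

namespace IsProxMap

variable {X : Set E} {F : E → ℝ} {lam c : ℝ} {p : E → E}

/-- Adding the growth inequalities at two points cancels the values of `F`. -/
theorem norm_sub_le (hp : IsProxMap X F lam c p) (hlam : 0 < lam) (x z : E) :
    c * ‖p z - p x‖ ≤ lam * ‖z - x‖ := by
  have h1 := hp.growth x (p z) (hp.mem z)
  have h2 := hp.growth z (p x) (hp.mem x)
  have e : ‖p z - x‖ ^ 2 + ‖p x - z‖ ^ 2 - ‖p x - x‖ ^ 2 - ‖p z - z‖ ^ 2 =
      2 * inner ℝ (p z - p x) (z - x) := by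
    simp only [norm_sub_sq_real, inner_sub_left, inner_sub_right]; ring
  have h3 := real_inner_le_norm (p z - p x) (z - x)
  rw [norm_sub_rev (p x) (p z)] at h2
  have h4 : c * ‖p z - p x‖ ^ 2 ≤ lam * inner ℝ (p z - p x) (z - x) := by nlinarith
  rcases (norm_nonneg (p z - p x)).eq_or_lt with h0 | h0
  · rw [← h0]; have := norm_nonneg (z - x); nlinarith
  · have h5 : 0 ≤ ‖p z - p x‖ * (lam * ‖z - x‖ - c * ‖p z - p x‖) := by nlinarith
    have := nonneg_of_mul_nonneg_right h5 h0
    linarith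

theorem continuous (hp : IsProxMap X F lam c p) (hlam : 0 < lam) (hc : 0 < c) :
    Continuous p := by
  refine (LipschitzWith.of_dist_le_mul (K := (lam / c).toNNReal) fun x y => ?_).continuous
  rw [Real.coe_toNNReal _ (by positivity), dist_eq_norm, dist_eq_norm, div_mul_eq_mul_div,
    le_div_iff₀ hc, mul_comm]
  exact hp.norm_sub_le hlam y x

/-- The envelope is differentiable: testing the infimum at `x` with the minimizer at `z`, and
conversely, bounds its increments from both sides up to `O(‖z - x‖²)`. -/
theorem hasGradientAt_moreauEnvelope [CompleteSpace E] (hp : IsProxMap X F lam c p)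
    (hlam : 0 < lam) (hc : 0 < c) (x : E) :
    HasGradientAt (moreauEnvelope X F lam) (lam • (x - p x)) x := by
  have hbound : ∀ z : E, ‖moreauEnvelope X F lam z - moreauEnvelope X F lam x -
      inner ℝ (lam • (x - p x)) (z - x)‖ ≤ (lam / 2 + lam * lam / c) * ‖z - x‖ ^ 2 := by
    intro z
    have h1 := hp.moreauEnvelope_le hc z (hp.mem x)
    have h2 := hp.moreauEnvelope_le hc x (hp.mem z)
    have ex := hp.moreauEnvelope_eq hc x
    have ez := hp.moreauEnvelope_eq hc z
    have e1 : ‖p x - z‖ ^ 2 =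
        ‖p x - x‖ ^ 2 + 2 * inner ℝ (x - p x) (z - x) + ‖z - x‖ ^ 2 := by
      have : p x - z = -((x - p x) + (z - x)) := by abel
      rw [this, norm_neg, norm_add_sq_real, norm_sub_rev x (p x)]
    have e2 : ‖p z - x‖ ^ 2 =
        ‖p z - z‖ ^ 2 - 2 * inner ℝ (z - p z) (z - x) + ‖z - x‖ ^ 2 := by
      have : p z - x = (z - x) - (z - p z) := by abel
      rw [this, norm_sub_sq_real, norm_sub_rev z (p z), real_inner_comm]
      ring
    have e3 : inner ℝ (z - p z) (z - x) = inner ℝ (x - p x) (z - x) + ‖z - x‖ ^ 2 -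
        inner ℝ (p z - p x) (z - x) := by
      have : z - p z = (x - p x) + (z - x) - (p z - p x) := by abel
      rw [this, inner_sub_left, inner_add_left, real_inner_self_eq_norm_sq]
    have h3 : inner ℝ (p z - p x) (z - x) ≤ lam / c * ‖z - x‖ ^ 2 := by
      have h4 := real_inner_le_norm (p z - p x) (z - x)
      have h5 : ‖p z - p x‖ ≤ lam / c * ‖z - x‖ := by
        rw [div_mul_eq_mul_div, le_div_iff₀ hc, mul_comm]; exact hp.norm_sub_le hlam x z
      nlinarith [norm_nonneg (z - x)]
    have h6 : 0 ≤ lam * lam / c * ‖z - x‖ ^ 2 := by positivity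
    have h7 : lam * inner ℝ (p z - p x) (z - x) ≤ lam * lam / c * ‖z - x‖ ^ 2 := by
      have := mul_le_mul_of_nonneg_left h3 hlam.le
      calc _ ≤ _ := this
        _ = _ := by ring
    rw [real_inner_smul_left, Real.norm_eq_abs, abs_le]
    rw [e1] at h1
    rw [e2, e3] at h2
    constructor <;> nlinarith
  rw [hasGradientAt_iff_isLittleO]
  have hO : (fun z => moreauEnvelope X F lam z - moreauEnvelope X F lam x -
      inner ℝ (lam • (x - p x)) (z - x)) =O[𝓝 x] fun z => ‖z - x‖ ^ 2 :=
    Asymptotics.IsBigO.of_bound (lam / 2 + lam * lam / c) (Eventually.of_forall fun z => by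
      simpa using hbound z)
  exact hO.trans_isLittleO (Asymptotics.isLittleO_pow_sub_sub x one_lt_two)

theorem mem_stationarySet (hp : IsProxMap X F lam c p) (hc : 0 < c) {x : E} (hx : p x = x) :
    x ∈ stationarySet X F := by
  refine mem_frechetSubdiffOn_of_quadratic (hx ▸ hp.mem x) (lam / 2) ?_
  filter_upwards [self_mem_nhdsWithin] with y hy
  have := (hp.isLeast hc x).2 ⟨⟨y, hy⟩, rfl⟩
  rw [hx, sub_self, norm_zero] at this
  rw [inner_zero_left]
  dsimp only at this
  linarith

/-- A bounded sequence along which the prox residual vanishes approaches the stationary set. -/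
theorem tendsto_infDist_stationarySet [FiniteDimensional ℝ E] (hp : IsProxMap X F lam c p)
    (hlam : 0 < lam) (hc : 0 < c) {x : ℕ → E} (hb : BddAbove (Set.range fun k => ‖x k‖))
    (hx : Tendsto (fun k => ‖p (x k) - x k‖) atTop (𝓝 0)) :
    Tendsto (fun k => Metric.infDist (x k) (stationarySet X F)) atTop (𝓝 0) := by
  obtain ⟨R, hR⟩ := hb
  have hR' : ∀ k, ‖x k‖ ≤ R := fun k => hR ⟨k, rfl⟩
  have hres : Continuous fun y => ‖p y - y‖ := ((hp.continuous hlam hc).sub continuous_id).norm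
  rw [Metric.tendsto_atTop]
  intro ε hε
  set K : Set E := Metric.closedBall 0 R ∩ {y | ε ≤ Metric.infDist y (stationarySet X F)} with hK
  have hKc : IsCompact K := (isCompact_closedBall 0 R).inter_right
    (isClosed_le continuous_const (Metric.continuous_infDist_pt _))
  have hev : ∀ᶠ k in atTop, x k ∉ K := by
    rcases K.eq_empty_or_nonempty with h | h
    · simp [h]
    obtain ⟨y, hyK, hy⟩ := hKc.exists_isMinOn h hres.continuousOn
    have hpos : 0 < ‖p y - y‖ := by
      rw [norm_pos_iff, sub_ne_zero]
      intro h
      have := hyK.2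
      rw [Set.mem_ofPred_eq, Metric.infDist_zero_of_mem (hp.mem_stationarySet hc h)] at this
      linarith
    filter_upwards [hx.eventually (gt_mem_nhds hpos)] with k hk hkK
    exact absurd (hy hkK) (not_le.2 hk)
  obtain ⟨N, hN⟩ := eventually_atTop.1 hev
  refine ⟨N, fun k hk => ?_⟩
  rw [Real.dist_eq, sub_zero, abs_of_nonneg Metric.infDist_nonneg]
  by_contra! h
  exact hN k hk ⟨by simpa using hR' k, h⟩

end IsProxMap

end Prox

/-! ### A deterministic convergence criterion -/

/-- If `∑ α k` diverges, `∑ α k * d k ^ 2` converges, and the increments `e k` of `d` are small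
where `d` is large in the sense that `∑ d k ^ 2 * e k` and `∑ e k ^ 2` converge, then `d` tends to
`0`: the increments of `d ^ 3` are summable. -/
theorem tendsto_zero_of_summable_increments {α d e : ℕ → ℝ} (hd : ∀ k, 0 ≤ d k)
    (hα : ∀ k, 0 ≤ α k) {D : ℝ} (hD : ∀ k, d k ≤ D)
    (hde : ∀ k, |d (k + 1) - d k| ≤ e k) (hαsum : ¬ Summable α)
    (h1 : Summable fun k => α k * d k ^ 2) (h2 : Summable fun k => d k ^ 2 * e k)
    (h3 : Summable fun k => e k ^ 2) : Tendsto d atTop (𝓝 0) := by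
  have hstep : ∀ k, dist (d k ^ 3) (d (k + 1) ^ 3) ≤
      3 * (d k ^ 2 * e k) + (3 * D + 2 * D) * e k ^ 2 := by
    intro k
    set δ := d (k + 1) - d k with hδ
    have e1 : d (k + 1) ^ 3 - d k ^ 3 = 3 * d k ^ 2 * δ + 3 * d k * δ ^ 2 + δ ^ 3 := by
      rw [hδ]; ring
    have hδ2 : δ ^ 2 ≤ e k ^ 2 := by
      rw [← sq_abs]; exact pow_le_pow_left₀ (abs_nonneg _) (hde k) 2
    have hδD : |δ| ≤ 2 * D := by
      rw [abs_le]; constructor <;> linarith [hd k, hD k, hd (k + 1), hD (k + 1)]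
    rw [dist_comm, Real.dist_eq, e1]
    calc |3 * d k ^ 2 * δ + 3 * d k * δ ^ 2 + δ ^ 3|
        ≤ |3 * d k ^ 2 * δ| + |3 * d k * δ ^ 2| + |δ ^ 3| := abs_add_three _ _ _
      _ = 3 * (d k ^ 2 * |δ|) + 3 * d k * δ ^ 2 + |δ| * δ ^ 2 := by
          rw [abs_mul, abs_of_nonneg (by positivity : 0 ≤ 3 * d k ^ 2), abs_of_nonneg
            (by have := hd k; positivity : 0 ≤ 3 * d k * δ ^ 2), abs_pow, pow_succ |δ|, sq_abs]
          ring
      _ ≤ 3 * (d k ^ 2 * e k) + 3 * D * e k ^ 2 + 2 * D * e k ^ 2 := by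
          have hD0 : 0 ≤ D := (hd k).trans (hD k)
          gcongr
          · exact hde k
          · exact hD k
      _ = _ := by ring
  have hsum : Summable fun k => 3 * (d k ^ 2 * e k) + (3 * D + 2 * D) * e k ^ 2 :=
    (h2.mul_left 3).add (h3.mul_left _)
  obtain ⟨l, hl⟩ := cauchySeq_tendsto_of_complete (cauchySeq_of_dist_le_of_summable _ hstep hsum)
  have hl0 : 0 ≤ l := ge_of_tendsto' hl fun k => pow_nonneg (hd k) 3
  have hlz : l = 0 := by
    by_contra hne
    have hlpos : 0 < l := lt_of_le_of_ne hl0 (Ne.symm hne)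
    apply hαsum
    have hD0 : 0 ≤ D := (hd 0).trans (hD 0)
    -- eventually `l / 2 ≤ d ^ 3 ≤ D * d ^ 2`, so that `α` is dominated by `α * d ^ 2`
    refine summable_of_isBigO_nat h1 (Asymptotics.IsBigO.of_bound (D / (l / 2)) ?_)
    filter_upwards [hl.eventually (lt_mem_nhds (half_lt_self hlpos))] with k hk
    have hk2 : l / 2 ≤ D * d k ^ 2 := by nlinarith [sq_nonneg (d k), hD k]
    rw [Real.norm_of_nonneg (hα k), Real.norm_of_nonneg (mul_nonneg (hα k) (sq_nonneg _)),
      div_mul_eq_mul_div, le_div_iff₀ (by positivity)]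
    nlinarith [hα k]
  rw [hlz] at hl
  have := hl.rpow_const (p := 1 / 3) (Or.inr (by norm_num))
  rw [Real.zero_rpow (by norm_num)] at this
  refine this.congr fun k => ?_
  rw [← Real.rpow_natCast, ← Real.rpow_mul (hd k)]
  norm_num

/-! ### Measurable bounds of subgradients -/

section SubgradientMeasurability

/-- The loss `f`, set to `0` off `U`, where it carries no information. -/
noncomputable def lossExt {E S : Type*} (U : Set E) (f : E → S → ℝ) (x : E) (s : S) : ℝ :=
  U.indicator (fun y => f y s) x

theorem lossExt_of_mem {E S : Type*} {U : Set E} {f : E → S → ℝ} {x : E} (hx : x ∈ U) (s : S) :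
    lossExt U f x s = f x s := Set.indicator_of_mem hx _

variable {E S : Type*} [NormedAddCommGroup E] [InnerProductSpace ℝ E]

/-- The positive part of the directional derivative of `f(·; s)` at `x` along `u`, written as an
upper limit of difference quotients so that its joint measurability is plain. -/
noncomputable def dirSlope (U : Set E) (f : E → S → ℝ) (u x : E) (s : S) : ℝ≥0∞ :=
  limsup (fun n : ℕ => ENNReal.ofReal
    ((n : ℝ) * (lossExt U f (x + (n : ℝ)⁻¹ • u) s - lossExt U f x s))) atTop

variable {U X : Set E} {f : E → S → ℝ} {ρ : S → ℝ}

theorem dirSlope_eq_ofReal_of_tendsto (hU : IsOpen U) {x : E} (hx : x ∈ U) (u : E) (s : S) {a : ℝ}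
    (h : Tendsto (fun n : ℕ => (n : ℝ) * (f (x + (n : ℝ)⁻¹ • u) s - f x s)) atTop (𝓝 a)) :
    dirSlope U f u x s = ENNReal.ofReal a := by
  refine Tendsto.limsup_eq ((ENNReal.continuous_ofReal.tendsto a).comp (h.congr' ?_))
  filter_upwards [(tendsto_add_inv_smul x u).eventually (hU.mem_nhds hx)] with n hn
  rw [lossExt_of_mem hn, lossExt_of_mem hx]

variable [FiniteDimensional ℝ E]

/-- A jointly measurable upper bound of the squared norms of the subgradients of `f(·; s)` at `x`:
the sum of the squared directional slopes along `± b i` for an orthonormal basis `b`. -/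
noncomputable def subgradSq (U : Set E) (f : E → S → ℝ) (x : E) (s : S) : ℝ≥0∞ :=
  ∑ i, (dirSlope U f (stdOrthonormalBasis ℝ E i) x s ^ 2 +
    dirSlope U f (-stdOrthonormalBasis ℝ E i) x s ^ 2)

theorem exists_mem_frechetSubdiff_dirSlope_eq (hU : IsOpen U)
    (hf : ∀ s, WeaklyConvexOn U (ρ s) (fun x => f x s)) {x : E} (hx : x ∈ U) (u : E) (s : S) :
    ∃ v ∈ frechetSubdiff (fun y => f y s) x, dirSlope U f u x s = ENNReal.ofReal (inner ℝ v u) := by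
  obtain ⟨v, hv, hlim⟩ := (hf s).exists_mem_frechetSubdiff_tendsto hU hx u
  exact ⟨v, hv, dirSlope_eq_ofReal_of_tendsto hU hx u s hlim⟩

theorem ofReal_inner_le_dirSlope (hU : IsOpen U)
    (hf : ∀ s, WeaklyConvexOn U (ρ s) (fun x => f x s)) {x : E} (hx : x ∈ U) (u : E) (s : S)
    {v : E} (hv : v ∈ frechetSubdiff (fun y => f y s) x) :
    ENNReal.ofReal (inner ℝ v u) ≤ dirSlope U f u x s := by
  obtain ⟨w, -, hlim⟩ := (hf s).exists_mem_frechetSubdiff_tendsto hU hx u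
  rw [dirSlope_eq_ofReal_of_tendsto hU hx u s hlim]
  refine ENNReal.ofReal_le_ofReal ?_
  have hlow : Tendsto (fun n : ℕ => inner ℝ v u - ρ s / 2 * ((n : ℝ)⁻¹ * ‖u‖ ^ 2)) atTop
      (𝓝 (inner ℝ v u - ρ s / 2 * (0 * ‖u‖ ^ 2))) :=
    ((tendsto_inv_atTop_nhds_zero_nat (𝕜 := ℝ)).mul_const _ |>.const_mul _).const_sub _
  rw [zero_mul, mul_zero, sub_zero] at hlow
  refine le_of_tendsto_of_tendsto hlow hlim ?_
  filter_upwards [eventually_gt_atTop 0, (tendsto_add_inv_smul x u).eventually (hU.mem_nhds hx)]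
    with n hn hnU
  have h := (hf s).le_of_mem_frechetSubdiff hx hnU hv
  have hn' : (0 : ℝ) < n := by exact_mod_cast hn
  rw [add_sub_cancel_left, inner_smul_right, norm_smul, mul_pow, Real.norm_eq_abs, sq_abs] at h
  have h6 := mul_le_mul_of_nonneg_left
    (show (n : ℝ)⁻¹ * inner ℝ v u - ρ s / 2 * ((n : ℝ)⁻¹ ^ 2 * ‖u‖ ^ 2) ≤
      f (x + (n : ℝ)⁻¹ • u) s - f x s by linarith) hn'.le
  refine le_trans (le_of_eq ?_) h6
  field_simp

theorem enorm_sq_le_subgradSq (hU : IsOpen U)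
    (hf : ∀ s, WeaklyConvexOn U (ρ s) (fun x => f x s)) {x : E} (hx : x ∈ U) (s : S)
    {v : E} (hv : v ∈ frechetSubdiff (fun y => f y s) x) :
    ‖v‖ₑ ^ 2 ≤ subgradSq U f x s := by
  have h1 : ‖v‖ₑ ^ 2 = ∑ i, ENNReal.ofReal (inner ℝ v (stdOrthonormalBasis ℝ E i) ^ 2) := by
    rw [← ofReal_norm, ← ENNReal.ofReal_pow (norm_nonneg _),
      ← ENNReal.ofReal_sum_of_nonneg fun i _ => sq_nonneg _,
      ← OrthonormalBasis.sum_sq_norm_inner_left (stdOrthonormalBasis ℝ E) v]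
    simp [sq_abs]
  rw [h1]
  refine Finset.sum_le_sum fun i _ => ?_
  have hp := ofReal_inner_le_dirSlope hU hf hx (stdOrthonormalBasis ℝ E i) s hv
  have hm := ofReal_inner_le_dirSlope hU hf hx (-stdOrthonormalBasis ℝ E i) s hv
  rw [inner_neg_right] at hm
  rcases le_total 0 (inner ℝ v (stdOrthonormalBasis ℝ E i)) with h | h
  · rw [ENNReal.ofReal_pow h]
    exact le_add_right (pow_le_pow_left' hp 2)
  · rw [← neg_sq, ENNReal.ofReal_pow (neg_nonneg.2 h)]
    exact le_add_left (pow_le_pow_left' hm 2)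

theorem subgradSq_lt_top (hU : IsOpen U)
    (hf : ∀ s, WeaklyConvexOn U (ρ s) (fun x => f x s)) {x : E} (hx : x ∈ U) (s : S) :
    subgradSq U f x s < ∞ := by
  have h : ∀ u, dirSlope U f u x s < ∞ := fun u => by
    obtain ⟨v, -, hv⟩ := exists_mem_frechetSubdiff_dirSlope_eq hU hf hx u s
    rw [hv]; exact ENNReal.ofReal_lt_top
  exact ENNReal.sum_lt_top.2 fun i _ => ENNReal.add_lt_top.2
    ⟨ENNReal.pow_lt_top (h _), ENNReal.pow_lt_top (h _)⟩

variable [MeasurableSpace S]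

/-- Each directional slope is attained by a selection of subgradients, so the moment bound on
selections, measurable or not, passes to the slopes. -/
theorem lintegral_subgradSq_le {P : Measure S} (hU : IsOpen U)
    (hf : ∀ s, WeaklyConvexOn U (ρ s) (fun x => f x s)) {x : E} (hx : x ∈ U)
    (hmeas : ∀ u, Measurable (dirSlope U f u x)) {B : ℝ≥0∞}
    (hB : ∀ g : S → E, (∀ s, g s ∈ frechetSubdiff (fun y => f y s) x) →
      ∫⁻ s, ‖g s‖ₑ ^ 2 ∂P ≤ B) :
    ∫⁻ s, subgradSq U f x s ∂P ≤ ∑ _i : Fin (Module.finrank ℝ E), (B + B) := by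
  have h : ∀ u : E, ‖u‖ = 1 → ∫⁻ s, dirSlope U f u x s ^ 2 ∂P ≤ B := by
    intro u hu
    choose g hg hgu using fun s => exists_mem_frechetSubdiff_dirSlope_eq hU hf hx u s
    refine le_trans (lintegral_mono fun s => ?_) (hB g hg)
    refine pow_le_pow_left' ?_ 2
    rw [hgu s, ← ofReal_norm]
    refine ENNReal.ofReal_le_ofReal ((real_inner_le_norm _ _).trans ?_)
    rw [hu, mul_one]
  unfold subgradSq
  have hm2 : ∀ u, Measurable fun s => dirSlope U f u x s ^ 2 := fun u => (hmeas u).pow_const 2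
  rw [lintegral_finsetSum _ fun i _ => by
    have h1 := hm2 (stdOrthonormalBasis ℝ E i)
    have h2 := hm2 (-stdOrthonormalBasis ℝ E i)
    fun_prop]
  refine Finset.sum_le_sum fun i _ => ?_
  rw [lintegral_add_left (hm2 _)]
  exact add_le_add (h _ (by simp)) (h _ (by simp))

variable [MeasurableSpace E] [BorelSpace E]

theorem measurable_lossExt (hU : IsOpen U)
    (hmeas : ∀ x ∈ U, Measurable (f x)) (hcont : ∀ s, ContinuousOn (fun x => f x s) U) :
    Measurable (Function.uncurry (lossExt U f)) := by
  have hsub : Measurable (Function.uncurry fun (x : U) (s : S) => f x s) :=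
    measurable_uncurry_of_continuous_of_measurable
      (fun s => continuousOn_iff_continuous_domRestrict.1 (hcont s)) fun x => hmeas x x.2
  have hset : MeasurableSet {q : E × S | q.1 ∈ U} := measurable_fst hU.measurableSet
  have hmap : Measurable fun q : {q : E × S | q.1 ∈ U} => ((⟨q.1.1, q.2⟩ : U), q.1.2) :=
    ((measurable_fst.comp measurable_subtype_coe).subtype_mk).prodMk
      (measurable_snd.comp measurable_subtype_coe)
  refine measurable_of_restrict_of_restrict_compl hset ?_ ?_
  · refine cast (congrArg Measurable ?_) (hsub.comp hmap)
    funext q; exact (lossExt_of_mem (show q.1.1 ∈ U from q.2) q.1.2).symm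
  · refine cast (congrArg Measurable ?_) (measurable_const (a := (0 : ℝ)))
    funext q; exact (Set.indicator_of_notMem (show q.1.1 ∉ U from q.2) fun y => f y q.1.2).symm

theorem measurable_dirSlope (hU : IsOpen U) (hmeas : ∀ x ∈ U, Measurable (f x))
    (hcont : ∀ s, ContinuousOn (fun x => f x s) U) (u : E) :
    Measurable (Function.uncurry (dirSlope U f u)) := by
  have h := measurable_lossExt hU hmeas hcont
  have hs : ∀ n : ℕ, Measurable fun q : E × S => ENNReal.ofReal
      ((n : ℝ) * (lossExt U f (q.1 + (n : ℝ)⁻¹ • u) q.2 - lossExt U f q.1 q.2)) := by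
    intro n
    have h1 : Measurable fun q : E × S => lossExt U f (q.1 + (n : ℝ)⁻¹ • u) q.2 :=
      h.comp ((measurable_fst.add_const _).prodMk measurable_snd)
    exact ((h1.sub h).const_mul _).ennreal_ofReal
  exact Measurable.limsup hs

theorem measurable_subgradSq (hU : IsOpen U) (hmeas : ∀ x ∈ U, Measurable (f x))
    (hcont : ∀ s, ContinuousOn (fun x => f x s) U) :
    Measurable (Function.uncurry (subgradSq U f)) := by
  have hm : ∀ u, Measurable fun q : E × S => dirSlope U f u q.1 q.2 ^ 2 := fun u =>
    (measurable_dirSlope hU hmeas hcont u).pow_const 2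
  have he : Function.uncurry (subgradSq U f) = fun q : E × S =>
      ∑ i, (dirSlope U f (stdOrthonormalBasis ℝ E i) q.1 q.2 ^ 2 +
        dirSlope U f (-stdOrthonormalBasis ℝ E i) q.1 q.2 ^ 2) := rfl
  rw [he]
  refine Finset.measurable_sum _ fun i _ => ?_
  have h1 := hm (stdOrthonormalBasis ℝ E i)
  have h2 := hm (-stdOrthonormalBasis ℝ E i)
  fun_prop

/-- `Q` is a jointly measurable bound of the squared norms of the subgradients of the losses over
`X`, whose mean is bounded on bounded subsets of `X`. -/
structure IsSubgradBound (P : Measure S) (X : Set E) (f : E → S → ℝ) (Q : E → S → ℝ) : Prop where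
  measurable : Measurable (Function.uncurry Q)
  nonneg : ∀ x s, 0 ≤ Q x s
  bound : ∀ x ∈ X, ∀ s, ∀ v ∈ frechetSubdiff (fun y => f y s) x, ‖v‖ ^ 2 ≤ Q x s
  integral : ∀ R : ℝ, ∃ C : ℝ, 0 ≤ C ∧ ∀ x ∈ X, ‖x‖ ≤ R → Integrable (Q x) P ∧ ∫ s, Q x s ∂P ≤ C

theorem exists_isSubgradBound {P : Measure S} (hU : IsOpen U) (hXU : X ⊆ U)
    (hmeas : ∀ x ∈ U, Measurable (f x)) (hf : ∀ s, WeaklyConvexOn U (ρ s) (fun x => f x s))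
    (hmoment : SubgradSecondMomentBound P X f) : ∃ Q, IsSubgradBound P X f Q := by
  have hcont := fun s => (hf s).continuousOn hU
  have hQ := measurable_subgradSq hU hmeas hcont
  refine ⟨fun x s => (subgradSq U f x s).toReal, hQ.ennreal_toReal,
    fun _ _ => ENNReal.toReal_nonneg, fun x hx s v hv => ?_, fun R => ?_⟩
  · have h := ENNReal.toReal_mono (subgradSq_lt_top hU hf (hXU hx) s).ne
      (enorm_sq_le_subgradSq hU hf (hXU hx) s hv)
    simpa using h
  · obtain ⟨G, hGm, hG⟩ := hmoment
    set C : ℝ≥0∞ := ∑ _i : Fin (Module.finrank ℝ E), ((G R.toNNReal : ℝ≥0∞) + G R.toNNReal) with hC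
    have hCtop : C ≠ ∞ := by
      rw [hC]; exact (ENNReal.sum_lt_top.2 fun i _ => by simp [ENNReal.add_lt_top]).ne
    refine ⟨C.toReal, ENNReal.toReal_nonneg, fun x hx hxR => ?_⟩
    have hle : ∫⁻ s, subgradSq U f x s ∂P ≤ C := by
      refine lintegral_subgradSq_le hU hf (hXU hx)
        (fun u => (measurable_dirSlope hU hmeas hcont u).of_uncurry_left) fun g hg => ?_
      refine (hG x hx g hg).trans ?_
      have : ‖x‖₊ ≤ R.toNNReal := by
        rw [← NNReal.coe_le_coe, coe_nnnorm]; exact hxR.trans (Real.le_coe_toNNReal R)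
      exact_mod_cast hGm this
    have hmx : Measurable (subgradSq U f x) := hQ.of_uncurry_left
    refine ⟨integrable_toReal_of_lintegral_ne_top hmx.aemeasurable (ne_top_of_le_ne_top hCtop hle),
      ?_⟩
    rw [integral_toReal hmx.aemeasurable
      (Eventually.of_forall fun s => subgradSq_lt_top hU hf (hXU hx) s)]
    exact ENNReal.toReal_mono hCtop hle

end SubgradientMeasurability

/-! ### The objective -/

section Objective

variable {E S : Type*} [NormedAddCommGroup E] [InnerProductSpace ℝ E] [MeasurableSpace S]
  {P : Measure S} {U X : Set E} {f : E → S → ℝ} {ρ : S → ℝ} {Q : E → S → ℝ}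

theorem weaklyConvexOn_objective (hX : Convex ℝ X) (hXU : X ⊆ U)
    (hfint : ∀ x ∈ X, Integrable (f x) P) (hρ : Integrable ρ P)
    (hf : ∀ s, WeaklyConvexOn U (ρ s) (fun x => f x s)) :
    WeaklyConvexOn X (∫ s, ρ s ∂P) (objective P f) := by
  have hi : ∀ x ∈ X, Integrable (fun s => f x s + ρ s / 2 * ‖x‖ ^ 2) P := fun x hx =>
    (hfint x hx).add ((hρ.div_const 2).mul_const _)
  have he : ∀ x ∈ X, objective P f x + (∫ s, ρ s ∂P) / 2 * ‖x‖ ^ 2 =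
      ∫ s, (f x s + ρ s / 2 * ‖x‖ ^ 2) ∂P := by
    intro x hx
    rw [integral_add (hfint x hx) ((hρ.div_const 2).mul_const _), integral_mul_const,
      integral_div]
    rfl
  refine ⟨hX, fun x hx y hy a b ha hb hab => ?_⟩
  dsimp only
  rw [he _ (hX hx hy ha hb hab), he x hx, he y hy, smul_eq_mul, smul_eq_mul,
    ← integral_const_mul, ← integral_const_mul,
    ← integral_add ((hi x hx).const_mul a) ((hi y hy).const_mul b)]
  refine integral_mono (hi _ (hX hx hy ha hb hab))
    (((hi x hx).const_mul a).add ((hi y hy).const_mul b)) fun s => ?_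
  exact (hf s).2 (hXU hx) (hXU hy) ha hb hab

variable [FiniteDimensional ℝ E] [MeasurableSpace E]

theorem loss_sub_le (hU : IsOpen U) (hXU : X ⊆ U)
    (hf : ∀ s, WeaklyConvexOn U (ρ s) (fun x => f x s)) (hQ : IsSubgradBound P X f Q)
    {x y : E} (hx : x ∈ X) (hy : y ∈ X) (s : S) :
    f x s - f y s ≤ (Q x s + 1) / 2 * ‖x - y‖ + |ρ s| / 2 * ‖x - y‖ ^ 2 := by
  obtain ⟨v, hv, -⟩ := (hf s).exists_mem_frechetSubdiff_tendsto hU (hXU hx) 0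
  have h1 := (hf s).le_of_mem_frechetSubdiff (hXU hx) (hXU hy) hv
  have h2 := hQ.bound x hx s v hv
  have h3 := neg_le_of_abs_le (abs_real_inner_le_norm v (y - x))
  have h4 : ‖v‖ ≤ (Q x s + 1) / 2 := by nlinarith [sq_nonneg (‖v‖ - 1)]
  rw [norm_sub_rev y x] at h1 h3
  have h5 := mul_le_mul_of_nonneg_right h4 (norm_nonneg (x - y))
  have h6 := mul_le_mul_of_nonneg_right (le_abs_self (ρ s)) (sq_nonneg ‖x - y‖)
  linarith

theorem abs_loss_sub_le (hU : IsOpen U) (hXU : X ⊆ U)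
    (hf : ∀ s, WeaklyConvexOn U (ρ s) (fun x => f x s)) (hQ : IsSubgradBound P X f Q)
    {x y : E} (hx : x ∈ X) (hy : y ∈ X) (s : S) :
    |f x s - f y s| ≤ (Q x s + Q y s + 1) / 2 * ‖x - y‖ + |ρ s| / 2 * ‖x - y‖ ^ 2 := by
  have h1 := loss_sub_le hU hXU hf hQ hx hy s
  have h2 := loss_sub_le hU hXU hf hQ hy hx s
  rw [norm_sub_rev y x] at h2
  have h3 := mul_nonneg (hQ.nonneg x s) (norm_nonneg (x - y))
  have h4 := mul_nonneg (hQ.nonneg y s) (norm_nonneg (x - y))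
  rw [abs_le]
  constructor <;> linarith

variable [IsProbabilityMeasure P]

theorem integral_abs_loss_sub_le (hU : IsOpen U) (hXU : X ⊆ U)
    (hfint : ∀ x ∈ X, Integrable (f x) P) (hρ : Integrable ρ P)
    (hf : ∀ s, WeaklyConvexOn U (ρ s) (fun x => f x s)) (hQ : IsSubgradBound P X f Q) {C : ℝ}
    {x y : E} (hx : x ∈ X) (hy : y ∈ X) (hxC : Integrable (Q x) P ∧ ∫ s, Q x s ∂P ≤ C)
    (hyC : Integrable (Q y) P ∧ ∫ s, Q y s ∂P ≤ C) :
    ∫ s, |f x s - f y s| ∂P ≤ (2 * C + 1) / 2 * ‖x - y‖ + (∫ s, |ρ s| ∂P) / 2 * ‖x - y‖ ^ 2 := by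
  have i1 : Integrable (fun s => (Q x s + Q y s + 1) / 2 * ‖x - y‖) P :=
    (((hxC.1.add hyC.1).add (integrable_const 1)).div_const 2).mul_const _
  have i2 : Integrable (fun s => |ρ s| / 2 * ‖x - y‖ ^ 2) P := (hρ.abs.div_const 2).mul_const _
  calc ∫ s, |f x s - f y s| ∂P
      ≤ ∫ s, ((Q x s + Q y s + 1) / 2 * ‖x - y‖ + |ρ s| / 2 * ‖x - y‖ ^ 2) ∂P :=
        integral_mono ((hfint x hx).sub (hfint y hy)).abs (i1.add i2) fun s =>
          abs_loss_sub_le hU hXU hf hQ hx hy s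
    _ = ((∫ s, Q x s ∂P) + (∫ s, Q y s ∂P) + 1) / 2 * ‖x - y‖ +
        (∫ s, |ρ s| ∂P) / 2 * ‖x - y‖ ^ 2 := by
        rw [integral_add i1 i2, integral_mul_const, integral_mul_const, integral_div,
          integral_div, integral_add (f := fun s => Q x s + Q y s) (hxC.1.add hyC.1)
            (integrable_const 1), integral_add hxC.1 hyC.1]
        simp
    _ ≤ _ := by
        gcongr
        linarith [hxC.2, hyC.2]

theorem continuousOn_objective (hU : IsOpen U) (hXU : X ⊆ U)
    (hfint : ∀ x ∈ X, Integrable (f x) P) (hρ : Integrable ρ P)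
    (hf : ∀ s, WeaklyConvexOn U (ρ s) (fun x => f x s)) (hQ : IsSubgradBound P X f Q) :
    ContinuousOn (objective P f) X := by
  intro x hx
  obtain ⟨C, -, hC⟩ := hQ.integral (‖x‖ + 1)
  rw [ContinuousWithinAt, tendsto_iff_dist_tendsto_zero]
  have hlim : Tendsto (fun y : E => (2 * C + 1) / 2 * ‖y - x‖ +
      (∫ s, |ρ s| ∂P) / 2 * ‖y - x‖ ^ 2) (𝓝[X] x) (𝓝 ((2 * C + 1) / 2 * ‖x - x‖ +
      (∫ s, |ρ s| ∂P) / 2 * ‖x - x‖ ^ 2)) :=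
    (Continuous.tendsto (by fun_prop) x).mono_left nhdsWithin_le_nhds
  simp only [sub_self, norm_zero, mul_zero, ne_eq, OfNat.ofNat_ne_zero, not_false_eq_true,
    zero_pow, add_zero] at hlim
  refine squeeze_zero' (Eventually.of_forall fun _ => dist_nonneg) ?_ hlim
  filter_upwards [self_mem_nhdsWithin, mem_nhdsWithin_of_mem_nhds (Metric.ball_mem_nhds x one_pos)]
    with y hy hyx
  have hyn : ‖y‖ ≤ ‖x‖ + 1 := by
    rw [Metric.mem_ball, dist_eq_norm] at hyx
    have := norm_le_norm_add_norm_sub' y x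
    linarith
  rw [Real.dist_eq, objective, objective, ← integral_sub (hfint y hy) (hfint x hx)]
  exact (abs_integral_le_integral_abs).trans
    (integral_abs_loss_sub_le hU hXU hfint hρ hf hQ hy hx (hC y hy hyn) (hC x hx (by linarith)))

end Objective

/-! ### Convergence of almost decreasing processes and independence -/

section Probability

variable {Ω : Type*} {mΩ : MeasurableSpace Ω} {μ : Measure Ω}

theorem ae_summable_of_summable_integral {g : ℕ → Ω → ℝ} (h0 : ∀ k ω, 0 ≤ g k ω)
    (hint : ∀ k, Integrable (g k) μ) (hsum : Summable fun k => ∫ ω, g k ω ∂μ) :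
    ∀ᵐ ω ∂μ, Summable fun k => g k ω := by
  have h1 : ∫⁻ ω, ∑' k, ENNReal.ofReal (g k ω) ∂μ ≠ ∞ := by
    rw [lintegral_tsum fun k => (hint k).aemeasurable.ennreal_ofReal]
    simp_rw [← fun k => ofReal_integral_eq_lintegral_ofReal (hint k)
      (Eventually.of_forall (h0 k))]
    exact hsum.tsum_ofReal_ne_top
  filter_upwards [ae_lt_top' (AEMeasurable.tsum fun k =>
    (hint k).aemeasurable.ennreal_ofReal) h1] with ω hω
  refine (ENNReal.summable_toReal hω.ne).congr fun k => ?_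
  rw [ENNReal.toReal_ofReal (h0 k ω)]

theorem summable_integral_of_integral_le {V D : ℕ → Ω → ℝ} {β : ℕ → ℝ}
    (hV0 : ∀ k ω, 0 ≤ V k ω) (hD0 : ∀ k ω, 0 ≤ D k ω) (hβ0 : ∀ k, 0 ≤ β k) (hβ : Summable β)
    (hstep : ∀ k, ∫ ω, V (k + 1) ω ∂μ ≤ ∫ ω, V k ω ∂μ - ∫ ω, D k ω ∂μ + β k) :
    Summable fun k => ∫ ω, D k ω ∂μ := by
  refine summable_of_sum_range_le (c := ∫ ω, V 0 ω ∂μ + ∑' k, β k)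
    (fun k => integral_nonneg (hD0 k)) fun n => ?_
  have h : ∀ n, ∑ k ∈ Finset.range n, ∫ ω, D k ω ∂μ + ∫ ω, V n ω ∂μ ≤
      ∫ ω, V 0 ω ∂μ + ∑ k ∈ Finset.range n, β k := by
    intro n
    induction n with
    | zero => simp
    | succ n ih =>
      rw [Finset.sum_range_succ, Finset.sum_range_succ]
      linarith [hstep n]
  have h1 := h n
  have h2 : 0 ≤ ∫ ω, V n ω ∂μ := integral_nonneg (hV0 n)
  have h3 := hβ.sum_le_tsum (Finset.range n) fun k _ => hβ0 k
  linarith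

/-- A bounded nonnegative process that decreases in mean, up to a summable error, over every event
of the past is a supermartingale plus a convergent series, hence converges almost surely. -/
theorem ae_tendsto_of_setIntegral_le [IsProbabilityMeasure μ] {ℱ : Filtration ℕ mΩ}
    {V : ℕ → Ω → ℝ} {β : ℕ → ℝ} {C : ℝ} (hadp : ∀ k, Measurable[ℱ k] (V k))
    (hV0 : ∀ k ω, 0 ≤ V k ω) (hVC : ∀ k ω, V k ω ≤ C) (hβ0 : ∀ k, 0 ≤ β k) (hβ : Summable β)
    (hstep : ∀ k, ∀ B, MeasurableSet[ℱ k] B →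
      ∫ ω in B, V (k + 1) ω ∂μ ≤ ∫ ω in B, V k ω ∂μ + β k * μ.real B) :
    ∀ᵐ ω ∂μ, ∃ l, Tendsto (fun k => V k ω) atTop (𝓝 l) := by
  have hVint : ∀ k, Integrable (V k) μ := fun k =>
    Integrable.of_bound ((hadp k).mono (ℱ.le k) le_rfl).aestronglyMeasurable C
      (Eventually.of_forall fun ω => by rw [Real.norm_of_nonneg (hV0 k ω)]; exact hVC k ω)
  set N : ℕ → Ω → ℝ := fun k ω => ∑ j ∈ Finset.range k, β j - V k ω with hN
  have hNint : ∀ k, Integrable (N k) μ := fun k => (integrable_const _).sub (hVint k)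
  have hsub : Submartingale N ℱ μ := by
    refine submartingale_of_setIntegral_le_succ (fun k => ?_) hNint fun k B hB => ?_
    · exact ((hadp k).const_sub _).stronglyMeasurable
    · have h := hstep k B hB
      simp only [hN]
      rw [integral_sub (integrable_const _) (hVint k).integrableOn,
        integral_sub (integrable_const _) (hVint (k + 1)).integrableOn, setIntegral_const,
        setIntegral_const, Finset.sum_range_succ, smul_eq_mul, smul_eq_mul]
      linarith
  have hbdd : ∀ k, eLpNorm (N k) 1 μ ≤ (Real.toNNReal (∑' k, β k + C) : ℝ≥0∞) := by
    intro k
    refine (eLpNorm_le_of_ae_bound (C := ∑' k, β k + C) (Eventually.of_forall fun ω => ?_)).trans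
      (by simp [ENNReal.ofReal])
    have h1 := hβ.sum_le_tsum (Finset.range k) fun j _ => hβ0 j
    have h2 : 0 ≤ ∑ j ∈ Finset.range k, β j := Finset.sum_nonneg fun j _ => hβ0 j
    rw [Real.norm_eq_abs, abs_le]
    constructor <;> simp only [hN] <;> linarith [hV0 k ω, hVC k ω]
  filter_upwards [hsub.exists_ae_tendsto_of_bdd hbdd] with ω ⟨l, hl⟩
  refine ⟨∑' k, β k - l, (hβ.hasSum.tendsto_sum_nat.sub hl).congr fun k => ?_⟩
  simp [hN]

variable {A S : Type*} [MeasurableSpace A] [MeasurableSpace S] {P : Measure S}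

/-- Integrating out a sample that is independent of `W`. -/
theorem integral_comp_eq_of_indepFun [IsProbabilityMeasure μ] [IsProbabilityMeasure P] {W : Ω → A}
    {ξ : Ω → S} (hW : Measurable W) (hξ : Measurable ξ) (hlaw : μ.map ξ = P)
    (hind : IndepFun W ξ μ) {Ψ : A → S → ℝ} (hΨ : Measurable (Function.uncurry Ψ)) {C : ℝ}
    (hint : ∀ ω, Integrable (Ψ (W ω)) P) (hC : ∀ ω, ∫ s, |Ψ (W ω) s| ∂P ≤ C) :
    Integrable (fun ω => Ψ (W ω) (ξ ω)) μ ∧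
      ∫ ω, Ψ (W ω) (ξ ω) ∂μ = ∫ ω, ∫ s, Ψ (W ω) s ∂P ∂μ := by
  have hmap : μ.map (fun ω => (W ω, ξ ω)) = (μ.map W).prod P := by
    rw [← hlaw]; exact hind.map_prod_eq_prod_map_map hW.aemeasurable hξ.aemeasurable
  have : IsProbabilityMeasure (μ.map W) := Measure.isProbabilityMeasure_map hW.aemeasurable
  have habs : StronglyMeasurable fun a => ∫ s, ‖Function.uncurry Ψ (a, s)‖ ∂P :=
    hΨ.norm.stronglyMeasurable.integral_prod_right'
  have hprod : Integrable (Function.uncurry Ψ) ((μ.map W).prod P) := by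
    rw [integrable_prod_iff hΨ.aestronglyMeasurable]
    refine ⟨?_, ?_⟩
    · have hset : MeasurableSet {a | Integrable (fun s => Function.uncurry Ψ (a, s)) P} :=
        measurableSet_integrable hΨ.stronglyMeasurable
      rw [ae_map_iff hW.aemeasurable hset]
      exact Eventually.of_forall hint
    · rw [integrable_map_measure habs.aestronglyMeasurable hW.aemeasurable]
      refine Integrable.of_bound (habs.measurable.comp hW).aestronglyMeasurable C
        (Eventually.of_forall fun ω => ?_)
      refine (Real.norm_of_nonneg (integral_nonneg fun s => norm_nonneg _)).trans_le ?_
      exact hC ω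
  have hmeas : Measurable fun ω => (W ω, ξ ω) := hW.prodMk hξ
  refine ⟨?_, ?_⟩
  · have h := hprod
    rw [← hmap, integrable_map_measure hΨ.aestronglyMeasurable hmeas.aemeasurable] at h
    exact h
  · have h1 := integral_map_of_stronglyMeasurable (μ := μ) hmeas hΨ.stronglyMeasurable
    have h2 := integral_map_of_stronglyMeasurable (μ := μ) hW
      (hΨ.stronglyMeasurable.integral_prod_right' (ν := P))
    rw [hmap, integral_prod _ hprod, h2] at h1
    exact h1.symm

/-- Integrating out a sample that is independent of a `σ`-field `𝒢`, over an event of `𝒢`. -/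
theorem setIntegral_comp_eq_of_indep {Ω : Type*} {𝒢 mΩ : MeasurableSpace Ω} {μ : Measure Ω}
    [IsProbabilityMeasure μ] [IsProbabilityMeasure P]
    (h𝒢 : 𝒢 ≤ mΩ) {W : Ω → A} {ξ : Ω → S} (hW : Measurable[𝒢] W)
    (hξ : Measurable ξ) (hlaw : μ.map ξ = P)
    (hind : Indep 𝒢 (MeasurableSpace.comap ξ inferInstance) μ) {B : Set Ω}
    (hB : MeasurableSet[𝒢] B) {Φ : A → S → ℝ} (hΦ : Measurable (Function.uncurry Φ)) {C : ℝ}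
    (hC0 : 0 ≤ C) (hint : ∀ ω ∈ B, Integrable (Φ (W ω)) P)
    (hC : ∀ ω ∈ B, ∫ s, |Φ (W ω) s| ∂P ≤ C) :
    IntegrableOn (fun ω => Φ (W ω) (ξ ω)) B μ ∧
      ∫ ω in B, Φ (W ω) (ξ ω) ∂μ = ∫ ω in B, ∫ s, Φ (W ω) s ∂P ∂μ := by
  -- the indicator of `B` is carried along as an extra coordinate of `W`
  set I : Ω → ℝ := B.indicator fun _ => 1 with hI
  have hI𝒢 : Measurable[𝒢] I := measurable_const.indicator hB
  have hWI : Measurable[𝒢] fun ω => (W ω, I ω) := hW.prodMk hI𝒢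
  have hind' : IndepFun (fun ω => (W ω, I ω)) ξ μ := by
    rw [IndepFun_iff_Indep]
    exact indep_of_indep_of_le_left hind hWI.comap_le
  have hΨ : Measurable (Function.uncurry fun (a : A × ℝ) (s : S) => a.2 * Φ a.1 s) :=
    (measurable_snd.comp measurable_fst).mul
      (hΦ.comp ((measurable_fst.comp measurable_fst).prodMk measurable_snd))
  have key := integral_comp_eq_of_indepFun (P := P) (C := C) (hWI.mono h𝒢 le_rfl) hξ hlaw hind' hΨ
    (fun ω => by
      by_cases hω : ω ∈ B
      · exact (hint ω hω).const_mul _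
      · simp [hI, hω])
    (fun ω => by
      by_cases hω : ω ∈ B
      · simpa [hI, hω] using hC ω hω
      · simpa [hI, hω] using hC0)
  have e1 : (fun ω => I ω * Φ (W ω) (ξ ω)) = B.indicator fun ω => Φ (W ω) (ξ ω) := by
    funext ω; by_cases hω : ω ∈ B <;> simp [hI, hω]
  have e2 : (fun ω => ∫ s, I ω * Φ (W ω) s ∂P) = B.indicator fun ω => ∫ s, Φ (W ω) s ∂P := by
    funext ω; by_cases hω : ω ∈ B <;> simp [hI, hω]
  have hB' : MeasurableSet B := h𝒢 _ hB
  obtain ⟨k1, k2⟩ := key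
  simp only at k1 k2
  rw [e1, integrable_indicator_iff hB'] at k1
  rw [e1, e2, integral_indicator hB', integral_indicator hB'] at k2
  exact ⟨k1, k2⟩

end Probability

section Filtration

variable {Ω S : Type*} {mΩ : MeasurableSpace Ω} [MeasurableSpace S] {μ : Measure Ω}

/-- The filtration of the fields generated by the samples before time `k`. -/
def pastFiltration (ξ : ℕ → Ω → S) (hξ : ∀ k, Measurable (ξ k)) : Filtration ℕ mΩ where
  seq := pastSigma ξ
  mono' _ _ hij := iSup₂_le fun l hl => le_iSup₂_of_le l (lt_of_lt_of_le hl hij) le_rfl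
  le' _ := iSup₂_le fun l _ => (hξ l).comap_le

theorem indep_pastSigma {ξ : ℕ → Ω → S} (hξ : ∀ k, Measurable (ξ k)) (hind : iIndepFun ξ μ)
    (k : ℕ) : Indep (pastSigma ξ k) (MeasurableSpace.comap (ξ k) inferInstance) μ := by
  have h := indep_iSup_of_disjoint (fun j => (hξ j).comap_le) hind.iIndep
    (S := {j | j < k}) (T := {k}) (by simp)
  simpa using h

end Filtration

/-! ### One step of the model-based method -/

section OneStep

variable {E S : Type*} [NormedAddCommGroup E] [InnerProductSpace ℝ E]
  {X U : Set E} {f : E → S → ℝ} {ρ : S → ℝ} {m : E → S → E → ℝ}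

/-- The growth inequality of the proximal model step, scaled by `2 a`. -/
theorem IsModel.step_growth (hm : IsModel X U f ρ m) (hX : Convex ℝ X) (hXU : X ⊆ U) {a : ℝ}
    (ha : 0 < a) {x y z : E} {s : S} (hx : x ∈ X) (hy : y ∈ X) (hz : z ∈ X)
    (hmin : IsMinOn (fun z => m x s z + 1 / (2 * a) * ‖z - x‖ ^ 2) X y) :
    2 * a * m x s y + ‖y - x‖ ^ 2 + ‖z - y‖ ^ 2 ≤ 2 * a * m x s z + ‖z - x‖ ^ 2 := by
  have h1 : StrongConvexOn X 0 (m x s) :=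
    strongConvexOn_zero.2 ((hm.convex x hx s).subset hXU hX)
  have h2 := strongConvexOn_add_sq h1 (1 / a) x
  have e : 1 / a / 2 = 1 / (2 * a) := by field_simp
  rw [zero_add, e] at h2
  have h3 := strongConvexOn_growth h2 hy hmin hz
  rw [e] at h3
  have h4 := mul_le_mul_of_nonneg_left h3 (by positivity : 0 ≤ 2 * a)
  have e2 : ∀ t : ℝ, 2 * a * (1 / (2 * a) * t) = t := fun t => by field_simp
  simp only [mul_add, e2] at h4
  exact h4

variable [MeasurableSpace S] [MeasurableSpace E] {P : Measure S} {Q : E → S → ℝ}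

/-- At the current iterate, the model has an affine minorant whose slope is a subgradient of the
loss. -/
theorem IsModel.exists_subgradient (hm : IsModel X U f ρ m) (hXU : X ⊆ U)
    (hQ : IsSubgradBound P X f Q) {x : E} (hx : x ∈ X) (s : S) :
    ∃ v : E, ‖v‖ ^ 2 ≤ Q x s ∧ ∀ y ∈ X, f x s - ‖v‖ * ‖y - x‖ ≤ m x s y := by
  obtain ⟨v, hv⟩ := hm.subdifferentiable x hx s x (hXU hx)
  refine ⟨v, hQ.bound x hx s v (hm.subdiff_subset x hx s hv), fun y hy => ?_⟩
  have h1 := le_of_mem_frechetSubdiff_of_convexOn (hm.convex x hx s) (hXU hx) (hXU hy) hv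
  have h2 := neg_le_of_abs_le (abs_real_inner_le_norm v (y - x))
  rw [hm.exact_at x hx s] at h1
  linarith

theorem IsModel.norm_step_sq_le (hm : IsModel X U f ρ m) (hX : Convex ℝ X) (hXU : X ⊆ U)
    (hQ : IsSubgradBound P X f Q) {a : ℝ} (ha : 0 < a) {x y : E} {s : S} (hx : x ∈ X)
    (hy : y ∈ X) (hmin : IsMinOn (fun z => m x s z + 1 / (2 * a) * ‖z - x‖ ^ 2) X y) :
    ‖y - x‖ ^ 2 ≤ a ^ 2 * Q x s := by
  obtain ⟨v, hv, hvm⟩ := hm.exists_subgradient hXU hQ hx s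
  have h1 := hm.step_growth hX hXU ha hx hy hx hmin
  have h2 := mul_le_mul_of_nonneg_left (hvm y hy) (by positivity : 0 ≤ 2 * a)
  rw [hm.exact_at x hx s, sub_self, norm_zero, norm_sub_rev x y] at h1
  have h3 : ‖y - x‖ ^ 2 ≤ (a * ‖v‖) * ‖y - x‖ := by nlinarith
  have h4 : ‖y - x‖ ^ 2 ≤ (a * ‖v‖) ^ 2 := by nlinarith [sq_nonneg (a * ‖v‖ - ‖y - x‖)]
  calc _ ≤ _ := h4
    _ = a ^ 2 * ‖v‖ ^ 2 := by ring
    _ ≤ _ := by gcongr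

/-- One step of the method compared with an arbitrary point `q` of `X`. -/
theorem IsModel.norm_sub_step_sq_le (hm : IsModel X U f ρ m) (hX : Convex ℝ X) (hXU : X ⊆ U)
    (hQ : IsSubgradBound P X f Q) {a : ℝ} (ha : 0 < a) {x y q : E} {s : S} (hx : x ∈ X)
    (hy : y ∈ X) (hq : q ∈ X)
    (hmin : IsMinOn (fun z => m x s z + 1 / (2 * a) * ‖z - x‖ ^ 2) X y) :
    ‖q - y‖ ^ 2 ≤ ‖q - x‖ ^ 2 + 2 * a * (f q s - f x s + ρ s / 2 * ‖q - x‖ ^ 2) +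
      a ^ 2 * Q x s := by
  obtain ⟨v, hv, hvm⟩ := hm.exists_subgradient hXU hQ hx s
  have h1 := hm.step_growth hX hXU ha hx hy hq hmin
  have h2 := mul_le_mul_of_nonneg_left (hvm y hy) (by positivity : 0 ≤ 2 * a)
  have h3 := mul_le_mul_of_nonneg_left (hm.weak_lower x hx s q hq) (by positivity : 0 ≤ 2 * a)
  have h4 := mul_le_mul_of_nonneg_left hv (sq_nonneg a)
  nlinarith [sq_nonneg (a * ‖v‖ - ‖y - x‖)]

end OneStep

section Method

variable {E S Ω : Type*} [NormedAddCommGroup E] [InnerProductSpace ℝ E]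
  [MeasurableSpace E] [MeasurableSpace S] {mΩ : MeasurableSpace Ω}
  {P : Measure S} {μ : Measure Ω}

/-- The data of a run of the model-based method: weakly convex losses `f` with subgradient bound
`Q`, models `m`, step sizes `α`, i.i.d. samples `ξ` and iterates `x`. -/
structure IsModelRun (P : Measure S) (μ : Measure Ω) (X U : Set E) (f : E → S → ℝ) (ρ : S → ℝ)
    (Q : E → S → ℝ) (m : E → S → E → ℝ) (α : ℕ → ℝ) (ξ : ℕ → Ω → S) (x : ℕ → Ω → E) : Prop where
  convex : Convex ℝ X
  isOpen : IsOpen U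
  subset : X ⊆ U
  measurable_loss : ∀ x ∈ U, Measurable (f x)
  integrable_loss : ∀ x ∈ X, Integrable (f x) P
  weaklyConvexOn : ∀ s, WeaklyConvexOn U (ρ s) (fun x => f x s)
  integrable_modulus : Integrable ρ P
  subgradBound : IsSubgradBound P X f Q
  model : IsModel X U f ρ m
  step_pos : ∀ k, 0 < α k
  summable_sq : Summable fun k => α k ^ 2
  measurable_sample : ∀ k, Measurable (ξ k)
  indep : iIndepFun ξ μ
  law : ∀ k, μ.map (ξ k) = P
  iteration : IsModelIteration X m α ξ x

namespace IsModelRun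

variable {X U : Set E} {f : E → S → ℝ} {ρ : S → ℝ} {Q : E → S → ℝ} {m : E → S → E → ℝ}
  {α : ℕ → ℝ} {ξ : ℕ → Ω → S} {x : ℕ → Ω → E}

theorem mem (h : IsModelRun P μ X U f ρ Q m α ξ x) (k : ℕ) (ω : Ω) : x k ω ∈ X := by
  cases k with
  | zero => exact h.iteration.init_mem ω
  | succ k => exact h.iteration.step_mem k ω

theorem measurable (h : IsModelRun P μ X U f ρ Q m α ξ x) (k : ℕ) : Measurable (x k) :=
  (h.iteration.adapted k).mono ((pastFiltration ξ h.measurable_sample).le k) le_rfl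

variable [FiniteDimensional ℝ E] [BorelSpace E] [IsProbabilityMeasure P] [IsProbabilityMeasure μ]

/-- Over an event of the past, the fresh factor `Q (x k) (ξ k)` can be replaced by the bound of its
mean. -/
theorem setIntegral_mul_le (h : IsModelRun P μ X U f ρ Q m α ξ x) {R C : ℝ} (hC0 : 0 ≤ C)
    (hC : ∀ y ∈ X, ‖y‖ ≤ R → Integrable (Q y) P ∧ ∫ s, Q y s ∂P ≤ C) {k : ℕ} {B : Set Ω}
    (hB : MeasurableSet[pastSigma ξ k] B) (hBR : ∀ ω ∈ B, ‖x k ω‖ ≤ R) {w : E → ℝ}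
    (hw : Continuous w) (hw0 : ∀ y, 0 ≤ w y) :
    IntegrableOn (fun ω => w (x k ω) * Q (x k ω) (ξ k ω)) B μ ∧
      ∫ ω in B, w (x k ω) * Q (x k ω) (ξ k ω) ∂μ ≤ C * ∫ ω in B, w (x k ω) ∂μ := by
  obtain ⟨M, hM⟩ := (isCompact_closedBall (0 : E) R).exists_bound_of_continuousOn hw.continuousOn
  have hM' : ∀ ω ∈ B, ‖w (x k ω)‖ ≤ M := fun ω hω => hM _ (by simpa using hBR ω hω)
  have hBm : MeasurableSet B := (pastFiltration ξ h.measurable_sample).le k B hB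
  have hint : ∀ ω ∈ B, ∫ s, w (x k ω) * Q (x k ω) s ∂P ≤ C * w (x k ω) := fun ω hω => by
    rw [integral_const_mul, mul_comm]
    exact mul_le_mul_of_nonneg_right (hC _ (h.mem k ω) (hBR ω hω)).2 (hw0 _)
  obtain ⟨h1, h2⟩ := setIntegral_comp_eq_of_indep (P := P) (C := C * max M 0)
    ((pastFiltration ξ h.measurable_sample).le k) (h.iteration.adapted k) (h.measurable_sample k)
    (h.law k) (indep_pastSigma h.measurable_sample h.indep k) hB
    (Φ := fun y s => w y * Q y s)
    ((hw.measurable.comp measurable_fst).mul h.subgradBound.measurable) (by positivity)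
    (fun ω hω => (hC _ (h.mem k ω) (hBR ω hω)).1.const_mul _)
    (fun ω hω => by
      have e : ∀ s, |w (x k ω) * Q (x k ω) s| = w (x k ω) * Q (x k ω) s := fun s =>
        abs_of_nonneg (mul_nonneg (hw0 _) (h.subgradBound.nonneg _ _))
      simp_rw [e]
      refine (hint ω hω).trans (mul_le_mul_of_nonneg_left ?_ hC0)
      exact ((le_abs_self _).trans (hM' ω hω)).trans (le_max_left _ _))
  refine ⟨h1, ?_⟩
  have hwi : IntegrableOn (fun ω => w (x k ω)) B μ :=
    Measure.integrableOn_of_bounded (measure_ne_top _ _)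
      (hw.measurable.comp (h.measurable k)).aestronglyMeasurable
      ((ae_restrict_iff' hBm).2 (Eventually.of_forall hM'))
  rw [h2, ← integral_const_mul]
  refine integral_mono_of_nonneg (Eventually.of_forall fun ω => integral_nonneg fun s =>
    mul_nonneg (hw0 _) (h.subgradBound.nonneg _ _)) (hwi.const_mul C) ?_
  exact (ae_restrict_iff' hBm).2 (Eventually.of_forall hint)

variable {lam : ℝ} {p : E → E}

/-- The mean decrease of the Moreau envelope in one step, over an event of the past on which the
current iterate is bounded: the proximal point of the current iterate is a candidate in the
infimum that defines the envelope at the next iterate. -/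
theorem setIntegral_envelope_le (h : IsModelRun P μ X U f ρ Q m α ξ x)
    (hlam : 0 < lam) (hc : 0 < lam - ∫ s, ρ s ∂P)
    (hp : IsProxMap X (objective P f) lam (lam - ∫ s, ρ s ∂P) p) {z : ℝ}
    (hz : ∀ y, z ≤ moreauEnvelope X (objective P f) lam y)
    (hcont : Continuous (moreauEnvelope X (objective P f) lam)) {R C : ℝ}
    (hC : ∀ y ∈ X, ‖y‖ ≤ R → Integrable (Q y) P ∧ ∫ s, Q y s ∂P ≤ C) {k : ℕ} {B : Set Ω}
    (hB : MeasurableSet[pastSigma ξ k] B) (hBR : ∀ ω ∈ B, ‖x k ω‖ ≤ R) :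
    IntegrableOn (fun ω => moreauEnvelope X (objective P f) lam (x (k + 1) ω) - z) B μ ∧
      ∫ ω in B, (moreauEnvelope X (objective P f) lam (x (k + 1) ω) - z) ∂μ ≤
        ∫ ω in B, (moreauEnvelope X (objective P f) lam (x k ω) - z) ∂μ -
        ∫ ω in B, lam * α k * (lam - ∫ s, ρ s ∂P) * ‖p (x k ω) - x k ω‖ ^ 2 ∂μ +
        lam / 2 * α k ^ 2 * C * μ.real B := by
  set φ := moreauEnvelope X (objective P f) lam with hφ
  set c := lam - ∫ s, ρ s ∂P with hcdef
  set a := α k with ha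
  have hapos : 0 < a := h.step_pos k
  have hpc := hp.continuous hlam hc
  have hBm : MeasurableSet B := (pastFiltration ξ h.measurable_sample).le k B hB
  -- the modulus `ρ` is only almost everywhere measurable, so it is replaced by a measurable copy
  set ρ' := h.integrable_modulus.1.mk ρ with hρ'
  have hρm : Measurable ρ' := h.integrable_modulus.1.stronglyMeasurable_mk.measurable
  have hρae : ρ =ᵐ[P] ρ' := h.integrable_modulus.1.ae_eq_mk
  have hρi : Integrable ρ' P := h.integrable_modulus.congr hρae
  have hρω : ∀ᵐ ω ∂μ, ρ (ξ k ω) = ρ' (ξ k ω) := by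
    have := hρae
    rw [← h.law k] at this
    exact ae_of_ae_map (h.measurable_sample k).aemeasurable this
  have hloss : Measurable (Function.uncurry (lossExt U f)) :=
    measurable_lossExt h.isOpen h.measurable_loss fun s =>
      (h.weaklyConvexOn s).continuousOn h.isOpen
  set Φ : E → S → ℝ := fun y s => lam * a * (lossExt U f (p y) s - lossExt U f y s +
    ρ' s / 2 * ‖p y - y‖ ^ 2) + lam / 2 * a ^ 2 * Q y s with hΦ
  have hΦm : Measurable (Function.uncurry Φ) := by
    have h1 : Measurable fun q : E × S => lossExt U f (p q.1) q.2 :=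
      hloss.comp ((hpc.measurable.comp measurable_fst).prodMk measurable_snd)
    have h2 : Measurable fun q : E × S => ρ' q.2 / 2 * ‖p q.1 - q.1‖ ^ 2 :=
      ((hρm.comp measurable_snd).div_const 2).mul
        (((hpc.sub continuous_id).norm.pow 2).measurable.comp measurable_fst)
    exact (((h1.sub hloss).add h2).const_mul _).add (h.subgradBound.measurable.const_mul _)
  have hΦeq : ∀ y ∈ X, Φ y = fun s => lam * a * (f (p y) s - f y s +
      ρ' s / 2 * ‖p y - y‖ ^ 2) + lam / 2 * a ^ 2 * Q y s := by
    intro y hy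
    funext s
    simp only [hΦ, lossExt_of_mem (h.subset hy), lossExt_of_mem (h.subset (hp.mem y))]
  -- bounds that hold uniformly over the iterates of norm at most `R`
  obtain ⟨M, hM⟩ := (isCompact_closedBall (0 : E) R).exists_bound_of_continuousOn hpc.continuousOn
  obtain ⟨D, hD0, hD⟩ : ∃ D : ℝ, 0 ≤ D ∧ ∀ y ∈ Metric.closedBall (0 : E) R, ‖p y - y‖ ≤ D := by
    obtain ⟨D, hD⟩ := (isCompact_closedBall (0 : E) R).exists_bound_of_continuousOn
      (hpc.sub continuous_id).continuousOn
    exact ⟨max D 0, le_max_right _ _, fun y hy => (hD y hy).trans (le_max_left _ _)⟩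
  obtain ⟨K, hK⟩ := (isCompact_closedBall (0 : E) R).exists_bound_of_continuousOn
    (hcont.sub continuous_const : Continuous fun y => φ y - z).continuousOn
  obtain ⟨C₁, hC₁0, hC₁⟩ := h.subgradBound.integral (max R M)
  set r := ∫ s, |ρ' s| ∂P with hr
  have hr0 : 0 ≤ r := integral_nonneg fun s => abs_nonneg _
  have hρabs : ∫ s, |ρ s| ∂P = r := integral_congr_ae (hρae.mono fun s hs => by simp [hs])
  have i1 : ∀ y ∈ X, Integrable (fun s => f (p y) s - f y s) P := fun y hy =>
    (h.integrable_loss _ (hp.mem y)).sub (h.integrable_loss y hy)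
  have i2 : ∀ y, Integrable (fun s => ρ' s / 2 * ‖p y - y‖ ^ 2) P := fun y =>
    (hρi.div_const 2).mul_const _
  have i12 : ∀ y ∈ X, Integrable (fun s => f (p y) s - f y s + ρ' s / 2 * ‖p y - y‖ ^ 2) P :=
    fun y hy => (i1 y hy).add (i2 y)
  have hΦi : ∀ y ∈ X, ‖y‖ ≤ R → Integrable (Φ y) P := by
    intro y hy hyR
    rw [hΦeq y hy]
    exact ((i12 y hy).const_mul _).add ((hC y hy hyR).1.const_mul _)
  have hΦabs : ∀ y ∈ X, ‖y‖ ≤ R → ∫ s, |Φ y s| ∂P ≤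
      lam * a * (((2 * C₁ + 1) / 2 * D + r / 2 * D ^ 2) + r / 2 * D ^ 2) +
        lam / 2 * a ^ 2 * C₁ := by
    intro y hy hyR
    have hyb : y ∈ Metric.closedBall (0 : E) R := by simpa using hyR
    have hQy := hC₁ y hy (hyR.trans (le_max_left _ _))
    have hQp := hC₁ (p y) (hp.mem y) ((hM y hyb).trans (le_max_right _ _))
    have hDy : ‖p y - y‖ ≤ D := hD y hyb
    have hf := integral_abs_loss_sub_le h.isOpen h.subset h.integrable_loss h.integrable_modulus
      h.weaklyConvexOn h.subgradBound (hp.mem y) hy hQp hQy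
    rw [hρabs] at hf
    have j1 : Integrable (fun s => |f (p y) s - f y s|) P := (i1 y hy).abs
    have j2 : Integrable (fun s => |ρ' s| / 2 * ‖p y - y‖ ^ 2) P :=
      (hρi.abs.div_const 2).mul_const _
    have j3 : Integrable (fun s => lam / 2 * a ^ 2 * Q y s) P := hQy.1.const_mul _
    have j4 : Integrable (fun s => lam * a * (|f (p y) s - f y s| +
      |ρ' s| / 2 * ‖p y - y‖ ^ 2)) P := (j1.add j2).const_mul _
    calc ∫ s, |Φ y s| ∂P
        ≤ ∫ s, (lam * a * (|f (p y) s - f y s| + |ρ' s| / 2 * ‖p y - y‖ ^ 2) +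
            lam / 2 * a ^ 2 * Q y s) ∂P := by
          refine integral_mono (hΦi y hy hyR).abs (j4.add j3) fun s => ?_
          rw [hΦeq y hy]
          dsimp only
          refine (abs_add_le _ _).trans (add_le_add ?_ (le_of_eq (abs_of_nonneg
            (mul_nonneg (by positivity) (h.subgradBound.nonneg _ _)))))
          rw [abs_mul, abs_of_pos (by positivity : 0 < lam * a)]
          gcongr
          refine (abs_add_le _ _).trans (add_le_add le_rfl (le_of_eq ?_))
          rw [abs_mul, abs_div, abs_of_nonneg (sq_nonneg ‖p y - y‖), abs_two]
      _ = lam * a * (∫ s, |f (p y) s - f y s| ∂P + r / 2 * ‖p y - y‖ ^ 2) +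
            lam / 2 * a ^ 2 * ∫ s, Q y s ∂P := by
          rw [integral_add j4 j3, integral_const_mul, integral_const_mul, integral_add j1 j2,
            integral_mul_const, integral_div]
      _ ≤ _ := by
          gcongr
          · refine hf.trans ?_
            gcongr
          · exact hQy.2
  have hΦle : ∀ y ∈ X, ‖y‖ ≤ R → ∫ s, Φ y s ∂P ≤
      -(lam * a * c * ‖p y - y‖ ^ 2) + lam / 2 * a ^ 2 * C := by
    intro y hy hyR
    have hQy := hC y hy hyR
    have hd := hp.apply_sub_le hy
    have hρ'i : ∫ s, ρ' s ∂P = lam - c := by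
      rw [← integral_congr_ae hρae, hcdef]; ring
    have e : ∫ s, Φ y s ∂P = lam * a * (objective P f (p y) - objective P f y +
        (lam - c) / 2 * ‖p y - y‖ ^ 2) + lam / 2 * a ^ 2 * ∫ s, Q y s ∂P := by
      rw [hΦeq y hy, integral_add ((i12 y hy).const_mul _) (hQy.1.const_mul _),
        integral_const_mul, integral_const_mul, integral_add (i1 y hy) (i2 y),
        integral_sub (h.integrable_loss _ (hp.mem y)) (h.integrable_loss y hy),
        integral_mul_const, integral_div, hρ'i]
      rfl
    rw [e]
    have h1 := mul_le_mul_of_nonneg_left hd (by positivity : 0 ≤ lam * a)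
    have h2 := mul_le_mul_of_nonneg_left hQy.2 (by positivity : 0 ≤ lam / 2 * a ^ 2)
    linarith
  have hbound0 : 0 ≤ lam * a * (((2 * C₁ + 1) / 2 * D + r / 2 * D ^ 2) + r / 2 * D ^ 2) +
      lam / 2 * a ^ 2 * C₁ := by positivity
  obtain ⟨hΦB, hΦeqB⟩ := setIntegral_comp_eq_of_indep (P := P)
    ((pastFiltration ξ h.measurable_sample).le k) (h.iteration.adapted k) (h.measurable_sample k)
    (h.law k) (indep_pastSigma h.measurable_sample h.indep k) hB hΦm hbound0
    (fun ω hω => hΦi _ (h.mem k ω) (hBR ω hω))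
    (fun ω hω => hΦabs _ (h.mem k ω) (hBR ω hω))
  -- the pointwise descent inequality
  have hpt : ∀ᵐ ω ∂μ, φ (x (k + 1) ω) - z ≤ φ (x k ω) - z + Φ (x k ω) (ξ k ω) := by
    filter_upwards [hρω] with ω hω
    have h1 := hp.moreauEnvelope_le hc (x (k + 1) ω) (hp.mem (x k ω))
    have h2 := hp.moreauEnvelope_eq hc (x k ω)
    have h3 := h.model.norm_sub_step_sq_le h.convex h.subset h.subgradBound hapos (h.mem k ω)
      (h.mem (k + 1) ω) (hp.mem (x k ω)) (h.iteration.step_min k ω)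
    rw [hω] at h3
    have h4 := mul_le_mul_of_nonneg_left h3 (by positivity : 0 ≤ lam / 2)
    rw [hΦeq _ (h.mem k ω)]
    dsimp only
    linarith
  have hbd : ∀ ω ∈ B, x k ω ∈ Metric.closedBall (0 : E) R := fun ω hω => by simpa using hBR ω hω
  have iφ : IntegrableOn (fun ω => φ (x k ω) - z) B μ :=
    Measure.integrableOn_of_bounded (M := K) (measure_ne_top _ _)
      ((hcont.measurable.comp (h.measurable k)).sub_const z).aestronglyMeasurable
      ((ae_restrict_iff' hBm).2 (Eventually.of_forall fun ω hω => hK _ (hbd ω hω)))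
  have idst : IntegrableOn (fun ω => lam * a * c * ‖p (x k ω) - x k ω‖ ^ 2) B μ := by
    refine Integrable.const_mul ?_ _
    refine Measure.integrableOn_of_bounded (M := D ^ 2) (measure_ne_top _ _)
      (((hpc.sub continuous_id).norm.pow 2).measurable.comp
        (h.measurable k)).aestronglyMeasurable
      ((ae_restrict_iff' hBm).2 (Eventually.of_forall fun ω hω => ?_))
    rw [Real.norm_of_nonneg (sq_nonneg _)]
    exact pow_le_pow_left₀ (norm_nonneg _) (hD _ (hbd ω hω)) 2
  have iφ' : IntegrableOn (fun ω => φ (x (k + 1) ω) - z) B μ := by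
    refine (iφ.add hΦB).mono'
      ((hcont.measurable.comp (h.measurable (k + 1))).sub_const z).aestronglyMeasurable
      (ae_restrict_of_ae ?_)
    filter_upwards [hpt] with ω hω
    rw [Real.norm_of_nonneg (sub_nonneg.2 (hz _))]
    exact hω
  refine ⟨iφ', ?_⟩
  calc ∫ ω in B, (φ (x (k + 1) ω) - z) ∂μ
      ≤ ∫ ω in B, (φ (x k ω) - z + Φ (x k ω) (ξ k ω)) ∂μ :=
        integral_mono_ae iφ' (iφ.add hΦB) (ae_restrict_of_ae hpt)
    _ = ∫ ω in B, (φ (x k ω) - z) ∂μ + ∫ ω in B, ∫ s, Φ (x k ω) s ∂P ∂μ := by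
        rw [integral_add iφ hΦB, hΦeqB]
    _ ≤ ∫ ω in B, (φ (x k ω) - z) ∂μ + ∫ ω in B, (-(lam * a * c * ‖p (x k ω) - x k ω‖ ^ 2) +
          lam / 2 * a ^ 2 * C) ∂μ := by
        refine add_le_add le_rfl (setIntegral_mono_on ?_ (idst.neg.add (integrable_const _)) hBm
          fun ω hω => hΦle _ (h.mem k ω) (hBR ω hω))
        refine Measure.integrableOn_of_bounded (measure_ne_top _ _)
          (hΦm.stronglyMeasurable.integral_prod_right'.measurable.comp
            (h.measurable k)).aestronglyMeasurable
          ((ae_restrict_iff' hBm).2 (Eventually.of_forall fun ω hω =>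
            (norm_integral_le_integral_norm _).trans (hΦabs _ (h.mem k ω) (hBR ω hω))))
    _ = _ := by
        have hneg : IntegrableOn (fun ω => -(lam * a * c * ‖p (x k ω) - x k ω‖ ^ 2)) B μ := idst.neg
        rw [integral_add hneg (integrable_const _), integral_neg, setIntegral_const, smul_eq_mul]
        ring

end IsModelRun

end Method

/-! ### Almost sure convergence -/

section Convergence

variable {E S Ω : Type*} [NormedAddCommGroup E] [InnerProductSpace ℝ E] [FiniteDimensional ℝ E]
  [MeasurableSpace E] [BorelSpace E] [MeasurableSpace S] {mΩ : MeasurableSpace Ω}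
  {P : Measure S} {μ : Measure Ω} [IsProbabilityMeasure P] [IsProbabilityMeasure μ]
  {X U : Set E} {f : E → S → ℝ} {ρ : S → ℝ} {Q : E → S → ℝ} {m : E → S → E → ℝ}
  {α : ℕ → ℝ} {ξ : ℕ → Ω → S} {x : ℕ → Ω → E} {lam : ℝ} {p : E → E}

namespace IsModelRun

/-- The almost sure convergence statements on the event that the iterates stay in the ball of
radius `R`. The processes are stopped when an iterate leaves that ball, which makes them bounded. -/
theorem ae_of_norm_le (h : IsModelRun P μ X U f ρ Q m α ξ x)
    (hlam : 0 < lam) (hc : 0 < lam - ∫ s, ρ s ∂P)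
    (hp : IsProxMap X (objective P f) lam (lam - ∫ s, ρ s ∂P) p) {z : ℝ}
    (hz : ∀ y, z ≤ moreauEnvelope X (objective P f) lam y) (R : ℝ) :
    ∀ᵐ ω ∂μ, (∀ k, ‖x k ω‖ ≤ R) →
      (∃ l, Tendsto (fun k => moreauEnvelope X (objective P f) lam (x k ω)) atTop (𝓝 l)) ∧
      (Summable fun k => α k * ‖p (x k ω) - x k ω‖ ^ 2) ∧
      (Summable fun k => ‖p (x k ω) - x k ω‖ ^ 2 * ‖x (k + 1) ω - x k ω‖) ∧
      (Summable fun k => ‖x (k + 1) ω - x k ω‖ ^ 2) := by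
  set φ := moreauEnvelope X (objective P f) lam with hφ
  set c := lam - ∫ s, ρ s ∂P with hcdef
  have hcont : Continuous φ := continuous_iff_continuousAt.2 fun y =>
    (hp.hasGradientAt_moreauEnvelope hlam hc y).differentiableAt.continuousAt
  have hres : Continuous fun y => ‖p y - y‖ ^ 2 :=
    ((hp.continuous hlam hc).sub continuous_id).norm.pow 2
  set ℱ : Filtration ℕ mΩ := pastFiltration ξ h.measurable_sample with hℱ
  have hadp : ∀ k, Measurable[ℱ k] (x k) := h.iteration.adapted
  obtain ⟨C, hC0, hC⟩ := h.subgradBound.integral R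
  obtain ⟨K, hK0, hK⟩ : ∃ K : ℝ, 0 ≤ K ∧ ∀ y : E, ‖y‖ ≤ R → φ y - z ≤ K := by
    obtain ⟨K, hK⟩ := (isCompact_closedBall (0 : E) R).exists_bound_of_continuousOn
      (hcont.sub continuous_const : Continuous fun y => φ y - z).continuousOn
    exact ⟨max K 0, le_max_right _ _, fun y hy =>
      ((le_abs_self _).trans (hK y (by simpa using hy))).trans (le_max_left _ _)⟩
  -- the event that the first `k + 1` iterates lie in the ball
  set A : ℕ → Set Ω := fun k => {ω | ∀ j ≤ k, ‖x j ω‖ ≤ R} with hA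
  have hAm : ∀ k, MeasurableSet[ℱ k] (A k) := by
    intro k
    have e : A k = ⋂ j, ⋂ (_ : j ≤ k), {ω | ‖x j ω‖ ≤ R} := by ext ω; simp [hA]
    rw [e]
    refine MeasurableSet.iInter fun j => MeasurableSet.iInter fun hj => ?_
    have hxj : Measurable[ℱ k] (x j) := (hadp j).mono (ℱ.mono hj) le_rfl
    exact hxj (measurableSet_le measurable_norm measurable_const)
  have hAm' : ∀ k, MeasurableSet (A k) := fun k => ℱ.le k _ (hAm k)
  have hAR : ∀ k, ∀ ω ∈ A k, ‖x k ω‖ ≤ R := fun k ω hω => hω k le_rfl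
  have hAmono : ∀ k, A (k + 1) ⊆ A k := fun k ω hω j hj => hω j (hj.trans k.le_succ)
  set V : ℕ → Ω → ℝ := fun k => (A k).indicator fun ω => φ (x k ω) - z with hV
  set D : ℕ → Ω → ℝ := fun k => (A k).indicator fun ω =>
    lam * α k * c * ‖p (x k ω) - x k ω‖ ^ 2 with hD
  set β : ℕ → ℝ := fun k => lam / 2 * α k ^ 2 * C with hβ
  have hV0 : ∀ k ω, 0 ≤ V k ω := fun k =>
    Set.indicator_nonneg fun ω _ => sub_nonneg.2 (hz _)
  have hD0 : ∀ k ω, 0 ≤ D k ω := fun k => Set.indicator_nonneg fun ω _ => by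
    have := h.step_pos k
    positivity
  have hVK : ∀ k ω, V k ω ≤ K := fun k ω =>
    Set.indicator_le' (fun ω hω => hK _ (hAR k ω hω)) (fun _ _ => hK0) ω
  have hβ0 : ∀ k, 0 ≤ β k := fun k => by positivity
  have hβs : Summable β := (h.summable_sq.mul_left (lam / 2)).mul_right C
  have hstep : ∀ k, ∀ B, MeasurableSet[ℱ k] B →
      ∫ ω in B, V (k + 1) ω ∂μ ≤ ∫ ω in B, V k ω ∂μ - ∫ ω in B, D k ω ∂μ + β k * μ.real B := by
    intro k B hB
    have hBA : MeasurableSet[ℱ k] (B ∩ A k) := hB.inter (hAm k)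
    obtain ⟨h1, h2⟩ := h.setIntegral_envelope_le hlam hc hp hz hcont hC hBA
      fun ω hω => hAR k ω hω.2
    rw [← hφ] at h1
    rw [← hφ, ← hcdef, show lam / 2 * α k ^ 2 * C = β k from rfl] at h2
    simp only [hV, hD]
    rw [setIntegral_indicator (hAm' _), setIntegral_indicator (hAm' _),
      setIntegral_indicator (hAm' _)]
    have h3 := setIntegral_mono_set h1 (Eventually.of_forall fun ω => sub_nonneg.2 (hz _))
      (Set.inter_subset_inter_right B (hAmono k)).eventuallyLE
    have h4 : β k * μ.real (B ∩ A k) ≤ β k * μ.real B :=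
      mul_le_mul_of_nonneg_left (measureReal_mono Set.inter_subset_left) (hβ0 k)
    linarith
  have hVtends : ∀ᵐ ω ∂μ, ∃ l, Tendsto (fun k => V k ω) atTop (𝓝 l) :=
    ae_tendsto_of_setIntegral_le (ℱ := ℱ) (fun k =>
      Measurable.indicator (((hcont.measurable.comp (hadp k))).sub_const z) (hAm k))
    hV0 hVK hβ0 hβs fun k B hB => (hstep k B hB).trans (by
      have h0 : 0 ≤ ∫ ω in B, D k ω ∂μ := integral_nonneg (hD0 k)
      gcongr
      exact sub_le_self _ h0)
  have hDsum : Summable fun k => ∫ ω, D k ω ∂μ :=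
    summable_integral_of_integral_le hV0 hD0 hβ0 hβs fun k => by
      simpa using hstep k Set.univ MeasurableSet.univ
  have hresint : ∀ k, IntegrableOn (fun ω => ‖p (x k ω) - x k ω‖ ^ 2) (A k) μ := by
    intro k
    obtain ⟨M, hM⟩ := (isCompact_closedBall (0 : E) R).exists_bound_of_continuousOn
      hres.continuousOn
    exact Measure.integrableOn_of_bounded (measure_ne_top _ _)
      (hres.measurable.comp (h.measurable k)).aestronglyMeasurable
      ((ae_restrict_iff' (hAm' k)).2 (Eventually.of_forall fun ω hω =>
        hM _ (by simpa using hAR k ω hω)))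
  have hDint : ∀ k, Integrable (D k) μ := fun k =>
    IntegrableOn.integrable_indicator ((hresint k).const_mul _) (hAm' k)
  have hDae := ae_summable_of_summable_integral hD0 hDint hDsum
  -- the second moments of the increments, weighted by the squared residuals and unweighted
  have hQ1 := fun k => h.setIntegral_mul_le hC0 hC (hAm k) (hAR k) hres fun y => by positivity
  have hQ2 := fun k => h.setIntegral_mul_le hC0 hC (hAm k) (hAR k) (w := fun _ => 1)
    continuous_const fun y => zero_le_one
  have hae1 : ∀ᵐ ω ∂μ, Summable fun k => (A k).indicator (fun ω =>
      α k * (‖p (x k ω) - x k ω‖ ^ 2 * Q (x k ω) (ξ k ω))) ω := by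
    refine ae_summable_of_summable_integral (fun k => Set.indicator_nonneg fun ω _ => ?_)
      (fun k => IntegrableOn.integrable_indicator ((hQ1 k).1.const_mul _) (hAm' k)) ?_
    · exact mul_nonneg (h.step_pos k).le (mul_nonneg (by positivity) (h.subgradBound.nonneg _ _))
    · refine Summable.of_nonneg_of_le (fun k => integral_nonneg (Set.indicator_nonneg fun ω _ => ?_))
        (fun k => ?_) (hDsum.mul_left (C / (lam * c)))
      · exact mul_nonneg (h.step_pos k).le
          (mul_nonneg (by positivity) (h.subgradBound.nonneg _ _))
      · rw [integral_indicator (hAm' k), integral_indicator (hAm' k), integral_const_mul,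
          integral_const_mul]
        calc _ ≤ α k * (C * ∫ ω in A k, ‖p (x k ω) - x k ω‖ ^ 2 ∂μ) :=
              mul_le_mul_of_nonneg_left (hQ1 k).2 (h.step_pos k).le
          _ = _ := by field_simp
  have hae2 : ∀ᵐ ω ∂μ, Summable fun k => (A k).indicator (fun ω =>
      α k ^ 2 * (1 * Q (x k ω) (ξ k ω))) ω := by
    refine ae_summable_of_summable_integral (fun k => Set.indicator_nonneg fun ω _ => ?_)
      (fun k => IntegrableOn.integrable_indicator ((hQ2 k).1.const_mul _) (hAm' k)) ?_
    · exact mul_nonneg (sq_nonneg _) (mul_nonneg zero_le_one (h.subgradBound.nonneg _ _))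
    · refine Summable.of_nonneg_of_le (fun k => integral_nonneg (Set.indicator_nonneg fun ω _ => ?_))
        (fun k => ?_) (h.summable_sq.mul_right C)
      · exact mul_nonneg (sq_nonneg _) (mul_nonneg zero_le_one (h.subgradBound.nonneg _ _))
      · rw [integral_indicator (hAm' k), integral_const_mul]
        refine mul_le_mul_of_nonneg_left ((hQ2 k).2.trans ?_) (sq_nonneg _)
        refine mul_le_of_le_one_right hC0 ?_
        rw [setIntegral_const, smul_eq_mul, mul_one]
        exact measureReal_le_one
  filter_upwards [hVtends, hDae, hae1, hae2] with ω ⟨l, hl⟩ hd h1 h2 hω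
  have hωA : ∀ k, ω ∈ A k := fun k j _ => hω j
  simp only [hV, hD, Set.indicator_of_mem (hωA _)] at hl hd h1 h2
  have hsq : ∀ k, ‖x (k + 1) ω - x k ω‖ ^ 2 ≤ α k ^ 2 * Q (x k ω) (ξ k ω) := fun k =>
    h.model.norm_step_sq_le h.convex h.subset h.subgradBound (h.step_pos k) (h.mem k ω)
      (h.mem (k + 1) ω) (h.iteration.step_min k ω)
  have hd' : Summable fun k => α k * ‖p (x k ω) - x k ω‖ ^ 2 := by
    refine (hd.mul_left (lam * c)⁻¹).congr fun k => ?_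
    field_simp
  refine ⟨⟨l + z, ?_⟩, hd', ?_, ?_⟩
  · refine (hl.add_const z).congr fun k => by ring
  · refine Summable.of_nonneg_of_le (fun k => by positivity) (fun k => ?_)
      ((hd'.add h1).mul_left (1 / 2))
    have hQ0 := h.subgradBound.nonneg (x k ω) (ξ k ω)
    have hle : ‖x (k + 1) ω - x k ω‖ ≤ α k * ((1 + Q (x k ω) (ξ k ω)) / 2) := by
      refine abs_le_of_sq_le_sq' ((hsq k).trans ?_) ?_ |>.2
      · rw [mul_pow]
        refine mul_le_mul_of_nonneg_left ?_ (sq_nonneg _)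
        nlinarith [sq_nonneg (1 - Q (x k ω) (ξ k ω))]
      · have := h.step_pos k
        positivity
    calc _ ≤ ‖p (x k ω) - x k ω‖ ^ 2 * (α k * ((1 + Q (x k ω) (ξ k ω)) / 2)) := by gcongr
      _ = _ := by ring
  · refine Summable.of_nonneg_of_le (fun k => by positivity) (fun k => ?_) h2
    simpa using hsq k

theorem ae_of_bddAbove (h : IsModelRun P μ X U f ρ Q m α ξ x)
    (hlam : 0 < lam) (hc : 0 < lam - ∫ s, ρ s ∂P)
    (hp : IsProxMap X (objective P f) lam (lam - ∫ s, ρ s ∂P) p) {z : ℝ}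
    (hz : ∀ y, z ≤ moreauEnvelope X (objective P f) lam y) :
    ∀ᵐ ω ∂μ, BddAbove (Set.range fun k => ‖x k ω‖) →
      (∃ l, Tendsto (fun k => moreauEnvelope X (objective P f) lam (x k ω)) atTop (𝓝 l)) ∧
      (Summable fun k => α k * ‖p (x k ω) - x k ω‖ ^ 2) ∧
      (Summable fun k => ‖p (x k ω) - x k ω‖ ^ 2 * ‖x (k + 1) ω - x k ω‖) ∧
      (Summable fun k => ‖x (k + 1) ω - x k ω‖ ^ 2) := by
  filter_upwards [ae_all_iff.2 fun R : ℕ => h.ae_of_norm_le hlam hc hp hz R] with ω hω ⟨M, hM⟩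
  obtain ⟨R, hR⟩ := exists_nat_ge M
  exact hω R fun k => (hM ⟨k, rfl⟩).trans hR

/-- If the step sizes are not summable, the residuals of the proximal map vanish along bounded
trajectories: they vary by at most a multiple of the increments of the iterates. -/
theorem ae_tendsto_residual (h : IsModelRun P μ X U f ρ Q m α ξ x)
    (hlam : 0 < lam) (hc : 0 < lam - ∫ s, ρ s ∂P)
    (hp : IsProxMap X (objective P f) lam (lam - ∫ s, ρ s ∂P) p) {z : ℝ}
    (hz : ∀ y, z ≤ moreauEnvelope X (objective P f) lam y) (hα : ¬ Summable α) :
    ∀ᵐ ω ∂μ, BddAbove (Set.range fun k => ‖x k ω‖) →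
      Tendsto (fun k => ‖p (x k ω) - x k ω‖) atTop (𝓝 0) := by
  set c := lam - ∫ s, ρ s ∂P with hcdef
  filter_upwards [h.ae_of_bddAbove hlam hc hp hz] with ω hω hb
  obtain ⟨-, h1, h2, h3⟩ := hω hb
  obtain ⟨R, hR⟩ := hb
  obtain ⟨D, hD⟩ := (isCompact_closedBall (0 : E) R).exists_bound_of_continuousOn
    ((hp.continuous hlam hc).sub continuous_id).continuousOn
  set L : ℝ := lam / c + 1 with hL
  refine tendsto_zero_of_summable_increments (e := fun k => L * ‖x (k + 1) ω - x k ω‖)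
    (fun k => norm_nonneg _) (fun k => (h.step_pos k).le) (D := D)
    (fun k => hD _ (by simpa using hR ⟨k, rfl⟩)) (fun k => ?_) hα h1
    ((h2.mul_left L).congr fun k => by ring) ((h3.mul_left (L ^ 2)).congr fun k => by ring)
  have hlip : ‖p (x (k + 1) ω) - p (x k ω)‖ ≤ lam / c * ‖x (k + 1) ω - x k ω‖ := by
    rw [div_mul_eq_mul_div, le_div_iff₀ hc, mul_comm]
    exact hp.norm_sub_le hlam _ _
  calc |‖p (x (k + 1) ω) - x (k + 1) ω‖ - ‖p (x k ω) - x k ω‖|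
      ≤ ‖(p (x (k + 1) ω) - x (k + 1) ω) - (p (x k ω) - x k ω)‖ := abs_norm_sub_norm_le _ _
    _ = ‖(p (x (k + 1) ω) - p (x k ω)) - (x (k + 1) ω - x k ω)‖ := by congr 1; abel
    _ ≤ ‖p (x (k + 1) ω) - p (x k ω)‖ + ‖x (k + 1) ω - x k ω‖ := norm_sub_le _ _
    _ ≤ L * ‖x (k + 1) ω - x k ω‖ := by rw [hL, add_mul, one_mul]; gcongr

end IsModelRun

end Convergence

theorem moreauEnvelope_zero {E : Type*} [NormedAddCommGroup E] (X : Set E) (F : E → ℝ) :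
    moreauEnvelope X F 0 = fun _ => ⨅ y : X, F y := by
  funext x; simp [moreauEnvelope]

end StochModel

theorem mainTheorem3
    {n : ℕ} {S : Type*} [MeasurableSpace S] (P : Measure S) [IsProbabilityMeasure P]
    {Ω : Type*} [MeasurableSpace Ω] (μ : Measure Ω) [IsProbabilityMeasure μ]
    -- the constraint set, and an open convex set on which the losses and models are convex
    (X U : Set (EuclideanSpace ℝ (Fin n)))
    (hXclosed : IsClosed X) (hXconvex : Convex ℝ X)
    (hUopen : IsOpen U) (hUconvex : Convex ℝ U) (hXU : X ⊆ U)
    -- weakly convex losses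
    (f : EuclideanSpace ℝ (Fin n) → S → ℝ) (ρ : S → ℝ)
    (hfmeas : ∀ x ∈ U, Measurable (f x))
    (hfint : ∀ x ∈ X, Integrable (f x) P)
    (hfweak : ∀ s, StochModel.WeaklyConvexOn U (ρ s) (fun x => f x s))
    -- the set of minimizers of the objective over the constraint set is nonempty
    (hopt : ∃ xstar ∈ X, IsMinOn (StochModel.objective P f) X xstar)
    (hmoment : StochModel.SubgradSecondMomentBound P X f)
    -- the model, the step sizes, the samples and the iterates
    (m : EuclideanSpace ℝ (Fin n) → S → EuclideanSpace ℝ (Fin n) → ℝ)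
    (hm : StochModel.IsModel X U f ρ m)
    (α : ℕ → ℝ) (hαpos : ∀ k, 0 < α k) (hαsq : Summable (fun k => α k ^ 2))
    (ξ : ℕ → Ω → S) (hξmeas : ∀ k, Measurable (ξ k))
    (hξindep : iIndepFun ξ μ) (hξlaw : ∀ k, μ.map (ξ k) = P)
    (x : ℕ → Ω → EuclideanSpace ℝ (Fin n))
    (hx : StochModel.IsModelIteration X m α ξ x)
    (lam : ℝ) (hlam0 : 0 ≤ lam) (hρint : Integrable ρ P) (hlam : ∫ s, ρ s ∂P < lam) :
    Differentiable ℝ (StochModel.moreauEnvelope X (StochModel.objective P f) lam) ∧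
    (∃ G : Ω → ℝ, Measurable G ∧
      ∀ᵐ ω ∂μ, BddAbove (Set.range fun k => ‖x k ω‖) →
        Summable (fun k => α k *
          ‖gradient (StochModel.moreauEnvelope X (StochModel.objective P f) lam) (x k ω)‖ ^ 2) ∧
        Tendsto (fun k => StochModel.moreauEnvelope X (StochModel.objective P f) lam (x k ω))
          atTop (𝓝 (G ω))) ∧
    (¬ Summable α →
      volume (StochModel.objective P f ''
        StochModel.stationarySet X (StochModel.objective P f)) = 0 →
      ∀ᵐ ω ∂μ, BddAbove (Set.range fun k => ‖x k ω‖) →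
        Tendsto (fun k =>
          ‖gradient (StochModel.moreauEnvelope X (StochModel.objective P f) lam) (x k ω)‖)
          atTop (𝓝 0) ∧
        Tendsto (fun k =>
          Metric.infDist (x k ω) (StochModel.stationarySet X (StochModel.objective P f)))
          atTop (𝓝 0)) := by
  obtain ⟨Q, hQ⟩ := StochModel.exists_isSubgradBound hUopen hXU hfmeas hfweak hmoment
  have hrun : StochModel.IsModelRun P μ X U f ρ Q m α ξ x :=
    ⟨hXconvex, hUopen, hXU, hfmeas, hfint, hfweak, hρint, hQ, hm, hαpos, hαsq, hξmeas, hξindep,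
      hξlaw, hx⟩
  obtain ⟨xs, hxs, hmin⟩ := hopt
  have hprox : ∀ l : ℝ, 0 < l → ∃ p, StochModel.IsProxMap X (StochModel.objective P f) l
      (l - ∫ s, ρ s ∂P) p := fun l hl =>
    StochModel.exists_isProxMap hXclosed
      (StochModel.weaklyConvexOn_objective hXconvex hXU hfint hρint hfweak)
      (StochModel.continuousOn_objective hUopen hXU hfint hρint hfweak hQ) hxs hmin hl
  have hlow : ∀ l : ℝ, 0 ≤ l → ∀ y, StochModel.objective P f xs ≤
      StochModel.moreauEnvelope X (StochModel.objective P f) l y := fun l hl y => by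
    have : Nonempty X := ⟨⟨xs, hxs⟩⟩
    refine le_ciInf fun w => ?_
    have h1 : StochModel.objective P f xs ≤ StochModel.objective P f w := hmin w.2
    have h2 : 0 ≤ l / 2 * ‖(w : EuclideanSpace ℝ (Fin n)) - y‖ ^ 2 := by positivity
    linarith
  rcases hlam0.eq_or_lt with h0 | hlampos
  · -- `lam = 0`: the envelope is constant, and stationarity is read off the envelope with `lam = 1`
    subst h0
    have hgrad : ∀ y, gradient
        (StochModel.moreauEnvelope X (StochModel.objective P f) 0) y = 0 := fun y => by
      rw [StochModel.moreauEnvelope_zero]; exact gradient_const y _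
    refine ⟨?_, ⟨fun _ => ⨅ y : X, StochModel.objective P f y, measurable_const, ?_⟩, ?_⟩
    · rw [StochModel.moreauEnvelope_zero]; exact differentiable_const _
    · refine Eventually.of_forall fun ω _ => ⟨?_, ?_⟩
      · simp only [hgrad, norm_zero, ne_eq, OfNat.ofNat_ne_zero, not_false_eq_true, zero_pow,
          mul_zero]
        exact summable_zero
      · rw [StochModel.moreauEnvelope_zero]; exact tendsto_const_nhds
    · intro hα _
      obtain ⟨p, hp⟩ := hprox 1 one_pos
      have hc : 0 < 1 - ∫ s, ρ s ∂P := by linarith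
      filter_upwards [hrun.ae_tendsto_residual one_pos hc hp (hlow 1 zero_le_one) hα] with ω hω hb
      refine ⟨?_, hp.tendsto_infDist_stationarySet one_pos hc hb (hω hb)⟩
      simp only [hgrad, norm_zero]
      exact tendsto_const_nhds
  · obtain ⟨p, hp⟩ := hprox lam hlampos
    have hc : 0 < lam - ∫ s, ρ s ∂P := sub_pos.2 hlam
    have hgrad : ∀ y, ‖gradient (StochModel.moreauEnvelope X (StochModel.objective P f) lam) y‖ =
        lam * ‖p y - y‖ := fun y => by
      rw [(hp.hasGradientAt_moreauEnvelope hlampos hc y).gradient, norm_smul,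
        Real.norm_of_nonneg hlam0, norm_sub_rev]
    have hdiff : Differentiable ℝ (StochModel.moreauEnvelope X (StochModel.objective P f) lam) :=
      fun y => (hp.hasGradientAt_moreauEnvelope hlampos hc y).differentiableAt
    refine ⟨hdiff, ⟨fun ω => limsup (fun k =>
      StochModel.moreauEnvelope X (StochModel.objective P f) lam (x k ω)) atTop, ?_, ?_⟩, ?_⟩
    · exact Measurable.limsup fun k => hdiff.continuous.measurable.comp (hrun.measurable k)
    · filter_upwards [hrun.ae_of_bddAbove hlampos hc hp (hlow lam hlam0)] with ω hω hb
      obtain ⟨⟨l, hl⟩, h1, -⟩ := hω hb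
      refine ⟨(h1.mul_left (lam ^ 2)).congr fun k => ?_, ?_⟩
      · rw [hgrad]; ring
      · rw [hl.limsup_eq]; exact hl
    · intro hα _
      filter_upwards [hrun.ae_tendsto_residual hlampos hc hp (hlow lam hlam0) hα] with ω hω hb
      refine ⟨?_, hp.tendsto_infDist_stationarySet hlampos hc hb (hω hb)⟩
      simp only [hgrad]
      simpa using (hω hb).const_mul lam
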